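/- For an integer $n \ge 1$, let a two-neighbor cellular automaton rule $f : \{0,\dots,n-1\}^2 \to \{0,\dots,n-1\}$ be chosen uniformly at random among all $n^{n^2}$ such rules, and let $\mathbb{P}$ be the corresponding probability. A rule $f$ evolves configurations $\xi_t : \mathbb{Z} \to \{0,\dots,n-1\}$ by $\xi_{t+1}(x) = f(\xi_t(x-1), \xi_t(x))$ for all $x \in \mathbb{Z}$. A periodic solution of $f$ with temporal period $\tau \ge 1$ and spatial period $\sigma \ge 1$ is a trajectory of $f$ such that $\sigma$ is the smallest positive integer $s$ with $\xi_0(x+s) = \xi_0(x)$ for all $x$, and $\tau$ is the smallest positive integer $t$ with $\xi_t = \xi_0$. Fix an integer $\tau \ge 1$, and let $Y'_{\tau,n} \in \{1,2,\dots\} \cup \{\infty\}$ be the smallest $\sigma$ such that the random rule $f$ has a periodic solution with temporal period $\tau$ and spatial period $\sigma$ (with $Y'_{\tau,n} = \infty$ if there is no such $\sigma$). For $\sigma \ge 1$ put $$\lambda_{\tau,\sigma} = \frac{1}{\tau\sigma} \sum_{d \mid \gcd(\tau,\sigma)} \varphi(d)\, d,$$ where $\varphi$ is Euler's totient function. Then,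 as $n \to \infty$, $Y'_{\tau,n}$ converges in distribution to a nontrivial (that is, not concentrated at a single point) probability distribution on the positive integers, whose distribution function is $y \mapsto 1 - \exp\left(-\sum_{\sigma=1}^{y} \lambda_{\tau,\sigma}\right)$; in particular, for every integer $y \ge 0$, $$\mathbb{P}(Y'_{\tau,n} \le y) \to 1 - \exp\left(-\sum_{\sigma=1}^{y} \lambda_{\tau,\sigma}\right).$$ -/

import Mathlib

open Filter MeasureTheory

namespace RandomCA

instance : OpensMeasurableSpace ℕ∞ := ⟨fun _ _ => trivial⟩

/-- A two-neighbor cellular automaton rule with the `n` states `0, …, n - 1`. -/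
abbrev Rule (n : ℕ) : Type := Fin n → Fin n → Fin n

instance (n : ℕ) : Nonempty (Rule n) := ⟨fun a _ => a⟩

/-- A spatial configuration: a state at every site of `ℤ`. -/
abbrev Config (n : ℕ) : Type := ℤ → Fin n

/-- One step of the evolution: `ξ_{t+1}(x) = f(ξ_t(x - 1), ξ_t(x))`. -/
def step {n : ℕ} (f : Rule n) (ξ : Config n) : Config n := fun x => f (ξ (x - 1)) (ξ x)

/-- The trajectory started at `ξ`: `trajectory f ξ t` is the configuration at time `t`. -/
def trajectory {n : ℕ} (f : Rule n) (ξ : Config n) (t : ℕ) : Config n := (step f)^[t] ξ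

/-- The set of periodic solutions of `f` with temporal period `τ` and spatial period `σ` (both
minimal), each given by its initial configuration, which determines the whole space-time
configuration. (Identifying translates would not change whether this set is empty.) -/
def periodicSolutions {n : ℕ} (f : Rule n) (τ σ : ℕ) : Set (Config n) :=
  {ξ | IsLeast {s : ℕ | 0 < s ∧ ∀ x : ℤ, ξ (x + s) = ξ x} σ ∧
       IsLeast {t : ℕ | 0 < t ∧ ∀ x : ℤ, trajectory f ξ t x = ξ x} τ}

/-- The smallest spatial period of a periodic solution of `f` with temporal period `τ`; it is `⊤`
(the minimum of the empty set) when `f` has no periodic solution with temporal period `τ`. -/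
noncomputable def smallestSpatialPeriod (τ : ℕ) {n : ℕ} (f : Rule n) : ℕ∞ :=
  ⨅ σ ∈ {σ : ℕ | (periodicSolutions f τ σ).Nonempty}, (σ : ℕ∞)

/-- The uniform probability measure on the `n ^ (n ^ 2)` rules with `n` states. -/
noncomputable def uniformRule (n : ℕ) : Measure (Rule n) :=
  (PMF.uniformOfFintype (Rule n)).toMeasure

instance (n : ℕ) : IsProbabilityMeasure (uniformRule n) := by
  unfold uniformRule
  infer_instance

/-- `λ_{τ, σ} = (1 / (τ σ)) ∑_{d ∣ gcd(τ, σ)} φ(d) d`. -/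
noncomputable def lam (τ σ : ℕ) : ℝ :=
  1 / ((τ : ℝ) * (σ : ℝ)) * ∑ d ∈ (Nat.gcd τ σ).divisors, (Nat.totient d : ℝ) * (d : ℝ)

end RandomCA

/-! A solution with periods `τ` and `σ` is a pattern `u` on the torus `ZMod τ × ZMod σ`, and `f` has
it exactly when `f` obeys the finite set `constraints u`. A consistent set `T` of constraints is
obeyed with probability `n ^ (-|T|)`, while `c` states can be chosen in at most `n ^ c` ways.
Patterns with fewer states than constraints therefore contribute only `O(1 / n)`
(`sum_nonsimpleSets_le`), and the simple ones decide the limit.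

In a simple pattern a state determines its two parents, so walking backwards around the torus shows
that patterns agreeing at one point agree everywhere (`eq_of_eq_at`). Hence two distinct overlapping
simple sets have jointly more constraints than states, and their joint occurrence also costs `O(1 /
n)`. Disjoint argument sets give independence, so a Poisson approximation for locally dependent
events (`abs_prob_forall_not_sub_exp_le`) shows that no solution of spatial period at most `y`
exists with probability `exp(-mean) + O(1 / n)`.

For the mean, a simple pattern with invariance subgroup `H` is an injection of the quotient by `H`
into the states, and minimality of the periods says that `H` meets both axes trivially. A set of `m`
constraints comes from its `m` translates, so `H` contributes one over its index in the limit
(`sum_image_constraints`). There are `φ(d)` such subgroups of each order `d` dividing both periods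
(`card_transverse`), which produces `lam`. Finally `lam τ σ ≥ 1 / (τ σ)`, so the mean diverges with
`y` and no mass escapes to infinity. -/

namespace RandomCA

open scoped BigOperators Classical

/-! ### Poisson approximation for locally dependent events -/

section PoissonApproximation

variable {Ω ι : Type*} [Fintype Ω]

/-- The probability of an event under the uniform distribution on a finite type. -/
noncomputable def prob (A : Ω → Prop) : ℝ := 𝔼 ω, if A ω then (1 : ℝ) else 0

theorem prob_nonneg (A : Ω → Prop) : 0 ≤ prob A :=
  Finset.expect_nonneg fun ω _ => by split_ifs <;> norm_num

theorem prob_mono {A B : Ω → Prop} (h : ∀ ω, A ω → B ω) : prob A ≤ prob B := by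
  refine Finset.expect_le_expect fun ω _ => ?_
  by_cases hA : A ω
  · simp [hA, h ω hA]
  · simp only [hA, if_false]; split_ifs <;> norm_num

theorem prob_not [Nonempty Ω] (A : Ω → Prop) : prob (fun ω => ¬ A ω) = 1 - prob A := by
  have h : (1 : ℝ) = 𝔼 _ω : Ω, (1 : ℝ) := by simp
  rw [eq_sub_iff_add_eq, prob, prob, ← Finset.expect_add_distrib, h]
  refine Finset.expect_congr rfl fun ω _ => ?_
  by_cases hA : A ω <;> simp [hA]

theorem prob_exists_le (I : Finset ι) (A : ι → Ω → Prop) :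
    prob (fun ω => ∃ i ∈ I, A i ω) ≤ ∑ i ∈ I, prob (A i) := by
  simp only [prob]
  rw [← Finset.expect_sum_comm]
  refine Finset.expect_le_expect fun ω _ => ?_
  split_ifs with h
  · obtain ⟨i, hi, hA⟩ := h
    refine le_trans ?_ (Finset.single_le_sum (f := fun i => if A i ω then (1 : ℝ) else 0)
      (fun j _ => by split_ifs <;> norm_num) hi)
    simp [hA]
  · exact Finset.sum_nonneg fun j _ => by split_ifs <;> norm_num

theorem prob_or_le (A B : Ω → Prop) : prob (fun ω => A ω ∨ B ω) ≤ prob A + prob B := by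
  simp only [prob]
  rw [← Finset.expect_add_distrib]
  refine Finset.expect_le_expect fun ω _ => ?_
  by_cases hA : A ω <;> by_cases hB : B ω <;> simp [hA, hB]

/-- The difference is `s ^ m * (1 - s ^ k)`, which vanishes for `k = 0` and is at most `1`
otherwise. With `k` the number of nearby events, this bounds the cost of ignoring them. -/
theorem one_sub_pow_le {s : ℝ} (h0 : 0 ≤ s) (h1 : s ≤ 1) (m k : ℕ) :
    0 ≤ s ^ m - s ^ (m + k) ∧ s ^ m - s ^ (m + k) ≤ k := by
  have hm : s ^ m ≤ 1 := pow_le_one₀ h0 h1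
  have hm0 : 0 ≤ s ^ m := pow_nonneg h0 m
  have hk0 : 0 ≤ s ^ k := pow_nonneg h0 k
  have hk : s ^ k ≤ 1 := pow_le_one₀ h0 h1
  rw [pow_add]
  refine ⟨by nlinarith, ?_⟩
  rcases Nat.eq_zero_or_pos k with rfl | hpos
  · simp
  · have : (1 : ℝ) ≤ k := by exact_mod_cast hpos
    nlinarith [mul_nonneg hm0 hk0]

/-- The number of events with index in `I` that occur at `ω`. -/
noncomputable def occurrences (I : Finset ι) (A : ι → Ω → Prop) (ω : Ω) : ℕ :=
  (I.filter fun i => A i ω).card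

omit [Fintype Ω] in
theorem cast_occurrences (I : Finset ι) (A : ι → Ω → Prop) (ω : Ω) :
    (occurrences I A ω : ℝ) = ∑ i ∈ I, if A i ω then (1 : ℝ) else 0 := by
  simp [occurrences]

omit [Fintype Ω] in
theorem occurrences_split (I : Finset ι) (A : ι → Ω → Prop) (p : ι → Prop) (ω : Ω) :
    occurrences I A ω =
      occurrences (I.filter fun j => ¬ p j) A ω + occurrences (I.filter p) A ω := by
  rw [occurrences, occurrences, occurrences, add_comm, Finset.filter_comm,
    Finset.filter_comm (s := I) (p := fun j => ¬ p j), Finset.card_filter_add_card_filter_not]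

theorem expect_occurrences (I : Finset ι) (A : ι → Ω → Prop) :
    𝔼 ω, (occurrences I A ω : ℝ) = ∑ i ∈ I, prob (A i) := by
  simp only [cast_occurrences, prob]
  rw [Finset.expect_sum_comm]

/-- The comparison of the two sides of the differential equation of the probability generating
function, for one event. -/
theorem abs_expect_sub_le (I : Finset ι) (A : ι → Ω → Prop) (near : ι → ι → Prop) (i : ι)
    (hi : i ∈ I) (hrefl : near i i) {s : ℝ} (h0 : 0 ≤ s) (h1 : s ≤ 1)
    (hind : (𝔼 ω, if A i ω then s ^ occurrences (I.filter fun j => ¬ near i j) A ω else 0) =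
        prob (A i) * 𝔼 ω, s ^ occurrences (I.filter fun j => ¬ near i j) A ω) :
    |(𝔼 ω, if A i ω then s ^ (occurrences I A ω - 1) else 0) -
        prob (A i) * 𝔼 ω, s ^ occurrences I A ω| ≤
      (∑ j ∈ I with near i j, prob (A i) * prob (A j)) +
        ∑ j ∈ I with near i j ∧ j ≠ i, prob (fun ω => A i ω ∧ A j ω) := by
  set far := I.filter fun j => ¬ near i j with hfar
  -- Both expectations are compared with the one that counts far events only; `d₁` and `d₂` are the
  -- resulting errors.
  set d₁ : ℝ := 𝔼 ω, if A i ω then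
    s ^ occurrences far A ω - s ^ (occurrences I A ω - 1) else 0 with hd₁
  set d₂ : ℝ := 𝔼 ω, (s ^ occurrences far A ω - s ^ occurrences I A ω) with hd₂
  have e₁ : (𝔼 ω, if A i ω then s ^ (occurrences I A ω - 1) else 0) =
      (𝔼 ω, if A i ω then s ^ occurrences far A ω else 0) - d₁ := by
    rw [hd₁, ← Finset.expect_sub_distrib]
    refine Finset.expect_congr rfl fun ω _ => ?_
    split_ifs <;> ring
  have e₂ : (𝔼 ω, s ^ occurrences I A ω) = (𝔼 ω, s ^ occurrences far A ω) - d₂ := by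
    rw [hd₂, ← Finset.expect_sub_distrib]
    refine Finset.expect_congr rfl fun ω _ => ?_
    ring
  have hp := prob_nonneg (A i)
  have b₂ : 0 ≤ d₂ ∧ d₂ ≤ ∑ j ∈ I with near i j, prob (A j) := by
    rw [← expect_occurrences]
    refine ⟨Finset.expect_nonneg fun ω _ => ?_, Finset.expect_le_expect fun ω _ => ?_⟩
    · rw [occurrences_split I A (near i) ω]
      exact (one_sub_pow_le h0 h1 _ _).1
    · rw [occurrences_split I A (near i) ω]
      exact (one_sub_pow_le h0 h1 _ _).2
  -- On `A i` the event `i` is itself one of the near ones, so it absorbs the `- 1` and only its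
  -- other neighbours remain.
  have key : ∀ ω, A i ω → occurrences I A ω - 1 =
      occurrences far A ω + occurrences (I.filter fun j => near i j ∧ j ≠ i) A ω := by
    intro ω hω
    rw [occurrences_split I A (near i) ω]
    have : occurrences (I.filter (near i)) A ω =
        occurrences (I.filter fun j => near i j ∧ j ≠ i) A ω + 1 := by
      rw [occurrences, occurrences, ← Finset.card_insert_of_notMem (a := i) (by simp)]
      congr 1
      ext j
      simp only [Finset.mem_filter, Finset.mem_insert]
      constructor
      · tauto
      · rintro (rfl | h) <;> tauto
    rw [this, ← hfar]
    omega
  have b₁ : 0 ≤ d₁ ∧ d₁ ≤ ∑ j ∈ I with near i j ∧ j ≠ i, prob (fun ω => A i ω ∧ A j ω) := by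
    constructor
    · refine Finset.expect_nonneg fun ω _ => ?_
      split_ifs with hω
      · rw [key ω hω]
        exact (one_sub_pow_le h0 h1 _ _).1
      · exact le_rfl
    · simp only [prob]
      rw [← Finset.expect_sum_comm]
      refine Finset.expect_le_expect fun ω _ => ?_
      split_ifs with hω
      · rw [key ω hω]
        refine (one_sub_pow_le h0 h1 _ _).2.trans ?_
        rw [cast_occurrences]
        simp [hω]
      · simp [hω]
  rw [e₁, e₂, hind, ← Finset.mul_sum, abs_le]
  have m₁ := mul_nonneg hp b₂.1
  have m₂ := mul_le_mul_of_nonneg_left b₂.2 hp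
  constructor <;> nlinarith [b₁.1, b₁.2]

/-- A Poisson approximation of the probability that none of the events `A i` occurs. -/
theorem abs_prob_forall_not_sub_exp_le [Nonempty Ω] (I : Finset ι) (A : ι → Ω → Prop) (near : ι → ι → Prop)
    (hrefl : ∀ i ∈ I, near i i)
    (hind : ∀ i ∈ I, ∀ s : ℝ,
      (𝔼 ω, if A i ω then s ^ occurrences (I.filter fun j => ¬ near i j) A ω else 0) =
        prob (A i) * 𝔼 ω, s ^ occurrences (I.filter fun j => ¬ near i j) A ω) :
    |prob (fun ω => ∀ i ∈ I, ¬ A i ω) - Real.exp (-∑ i ∈ I, prob (A i))| ≤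
      (∑ i ∈ I, ∑ j ∈ I with near i j, prob (A i) * prob (A j)) +
        ∑ i ∈ I, ∑ j ∈ I with near i j ∧ j ≠ i, prob (fun ω => A i ω ∧ A j ω) := by
  set ε := (∑ i ∈ I, ∑ j ∈ I with near i j, prob (A i) * prob (A j)) +
        ∑ i ∈ I, ∑ j ∈ I with near i j ∧ j ≠ i, prob (fun ω => A i ω ∧ A j ω) with hε
  set l := ∑ i ∈ I, prob (A i) with hl
  have hl0 : 0 ≤ l := Finset.sum_nonneg fun i _ => prob_nonneg _
  -- The generating function of the number of occurrences: it runs from `1` at `t = 0` to the wanted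
  -- probability at `t = 1`, and nearly solves `g' = -l g`.
  set g : ℝ → ℝ := fun t => 𝔼 ω, (1 - t) ^ occurrences I A ω with hg
  set g' : ℝ → ℝ := fun t =>
    -∑ i ∈ I, 𝔼 ω, if A i ω then (1 - t) ^ (occurrences I A ω - 1) else 0 with hg'
  have hderiv : ∀ t, HasDerivAt g (g' t) t := by
    intro t
    have h : HasDerivAt g
        (𝔼 ω, (occurrences I A ω : ℝ) * (1 - t) ^ (occurrences I A ω - 1) * (-1)) t := by
      simp only [hg, Fintype.expect_eq_sum_div_card]
      refine HasDerivAt.div_const (HasDerivAt.fun_sum fun ω _ => ?_) _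
      exact ((hasDerivAt_id t).const_sub 1).pow _
    convert h using 1
    simp only [hg']
    rw [← Finset.expect_sum_comm, ← Finset.expect_neg_distrib]
    refine Finset.expect_congr rfl fun ω _ => ?_
    rw [cast_occurrences, mul_neg_one, Finset.sum_mul]
    congr 1
    refine Finset.sum_congr rfl fun i _ => ?_
    split_ifs <;> simp
  have hbound : ∀ t ∈ Set.Icc (0 : ℝ) 1, |g' t + l * g t| ≤ ε := by
    rintro t ⟨ht0, ht1⟩
    have : g' t + l * g t = -∑ i ∈ I,
        ((𝔼 ω, if A i ω then (1 - t) ^ (occurrences I A ω - 1) else 0) -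
          prob (A i) * 𝔼 ω, (1 - t) ^ occurrences I A ω) := by
      rw [Finset.sum_sub_distrib, ← Finset.sum_mul]
      simp only [hg', hg, hl]
      ring
    rw [this, abs_neg, hε, ← Finset.sum_add_distrib]
    refine (Finset.abs_sum_le_sum_abs _ _).trans (Finset.sum_le_sum fun i hi => ?_)
    exact abs_expect_sub_le I A near i hi (hrefl i hi) (by linarith) (by linarith) (hind i hi _)
  -- The integrating factor `exp (l t)` turns the approximate equation into a bound on one
  -- derivative.
  have hexp : ∀ t, HasDerivAt (fun t => Real.exp (l * t) * g t)
      (Real.exp (l * t) * (g' t + l * g t)) t := by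
    intro t
    have h1 : HasDerivAt (fun t => Real.exp (l * t)) (Real.exp (l * t) * l) t := by
      simpa using ((hasDerivAt_id t).const_mul l).exp
    exact (h1.fun_mul (hderiv t)).congr_deriv (by ring)
  have hmvt := norm_image_sub_le_of_norm_deriv_le_segment_01'
    (f := fun t => Real.exp (l * t) * g t)
    (f' := fun t => Real.exp (l * t) * (g' t + l * g t)) (C := Real.exp l * ε)
    (fun t _ => (hexp t).hasDerivWithinAt) (by
      rintro t ⟨ht0, ht1⟩
      rw [Real.norm_eq_abs, abs_mul, abs_of_pos (Real.exp_pos _)]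
      refine mul_le_mul ?_ (hbound t ⟨ht0, ht1.le⟩) (abs_nonneg _) (Real.exp_pos _).le
      exact Real.exp_le_exp.2 (by nlinarith))
  have g0 : g 0 = 1 := by simp [hg]
  have g1 : g 1 = prob (fun ω => ∀ i ∈ I, ¬ A i ω) := by
    simp only [hg, prob]
    refine Finset.expect_congr rfl fun ω _ => ?_
    -- At `t = 1` the integrand is `0 ^ W`, the indicator of `W = 0`.
    simp [zero_pow_eq, occurrences, Finset.filter_eq_empty_iff]
  simp only [mul_one, mul_zero, Real.exp_zero, g0, g1, Real.norm_eq_abs] at hmvt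
  have hfac : prob (fun ω => ∀ i ∈ I, ¬ A i ω) - Real.exp (-l) =
      Real.exp (-l) * (Real.exp l * prob (fun ω => ∀ i ∈ I, ¬ A i ω) - 1) := by
    rw [mul_sub, ← mul_assoc, ← Real.exp_add]
    simp
  rw [hfac, abs_mul, abs_of_pos (Real.exp_pos _)]
  calc Real.exp (-l) * _ ≤ Real.exp (-l) * (Real.exp l * ε) :=
        mul_le_mul_of_nonneg_left hmvt (Real.exp_pos _).le
    _ = ε := by rw [← mul_assoc, ← Real.exp_add]; simp

end PoissonApproximation

/-! ### Constraint sets: probability, independence, counting by colours -/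

section LocalEvents

/-- Independence of the coordinates of a uniform function: split it into its restrictions to `D` and
to the complement; the condition pins the first and `φ` sees only the second. -/
theorem expect_ite_eqOn {α β : Type*} [Fintype α] [DecidableEq α] [Fintype β] [DecidableEq β] [Nonempty β] (D : Finset α)
    (s : α → β) (φ : (α → β) → ℝ)
    (hφ : ∀ h h' : α → β, (∀ a ∉ D, h a = h' a) → φ h = φ h') :
    (𝔼 h, if ∀ a ∈ D, h a = s a then φ h else 0) =
      (Fintype.card β : ℝ)⁻¹ ^ D.card * 𝔼 h, φ h := by
  set e := Equiv.piEquivPiSubtypeProd (fun a => a ∈ D) (fun _ : α => β)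
  set a₀ : {a // a ∈ D} → β := fun a => s a
  have h1 : ∀ a b, φ (e.symm (a, b)) = φ (e.symm (a₀, b)) := by
    intro a b
    refine hφ _ _ fun x hx => ?_
    simp [e, Equiv.piEquivPiSubtypeProd, hx]
  have h2 : ∀ a b, (∀ x ∈ D, e.symm (a, b) x = s x) ↔ a = a₀ := by
    intro a b
    constructor
    · intro h
      ext ⟨x, hx⟩
      have := h x hx
      simpa [e, Equiv.piEquivPiSubtypeProd, hx, a₀] using this
    · rintro rfl x hx
      simp [e, Equiv.piEquivPiSubtypeProd, hx, a₀]
  have s1 : (∑ h : α → β, if ∀ a ∈ D, h a = s a then φ h else 0) =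
      ∑ b, φ (e.symm (a₀, b)) := by
    rw [← e.symm.sum_comp, Fintype.sum_prod_type_right]
    refine Finset.sum_congr rfl fun b _ => ?_
    simp only [h2]
    simp
  have s2 : (∑ h : α → β, φ h) = (Fintype.card β : ℝ) ^ D.card * ∑ b, φ (e.symm (a₀, b)) := by
    rw [← e.symm.sum_comp, Fintype.sum_prod_type]
    simp only [h1]
    simp
  have hβ : (Fintype.card β : ℝ) ≠ 0 := by exact_mod_cast Fintype.card_ne_zero
  rw [Fintype.expect_eq_sum_div_card, Fintype.expect_eq_sum_div_card, s1, s2, ← mul_div_assoc,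
    ← mul_assoc, inv_pow, inv_mul_cancel₀ (pow_ne_zero _ hβ), one_mul]

variable {n : ℕ}

/-- The rule `f` satisfies all the constraints `f a b = c` with `((a, b), c) ∈ T`. -/
def Agrees (T : Finset ((Fin n × Fin n) × Fin n)) (f : Rule n) : Prop :=
  ∀ q ∈ T, f q.1.1 q.1.2 = q.2

/-- The constraints in `T` do not contradict each other. -/
def Functional (T : Finset ((Fin n × Fin n) × Fin n)) : Prop :=
  Set.InjOn Prod.fst (T : Set ((Fin n × Fin n) × Fin n))

theorem Agrees.functional {T : Finset ((Fin n × Fin n) × Fin n)} {f : Rule n} (h : Agrees T f) :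
    Functional T := by
  intro p hp q hq hpq
  refine Prod.ext hpq ?_
  rw [← h p hp, ← h q hq, hpq]

theorem expect_ite_agrees [NeZero n] {T : Finset ((Fin n × Fin n) × Fin n)} (hT : Functional T)
    (φ : Rule n → ℝ)
    (hφ : ∀ f f' : Rule n, (∀ a b, (a, b) ∉ T.image Prod.fst → f a b = f' a b) → φ f = φ f') :
    (𝔼 f, if Agrees T f then φ f else 0) = (n : ℝ)⁻¹ ^ T.card * 𝔼 f, φ f := by
  -- Consistent constraints form a partial function; its extension by `0` is only ever evaluated at
  -- constrained arguments.
  have hs : ∃ s : Fin n × Fin n → Fin n, ∀ q ∈ T, s q.1 = q.2 := by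
    refine ⟨fun p => if h : ∃ q ∈ T, q.1 = p then h.choose.2 else 0, fun q hq => ?_⟩
    have h : ∃ q' ∈ T, q'.1 = q.1 := ⟨q, hq, rfl⟩
    simp only [h, dif_pos]
    rw [hT h.choose_spec.1 hq h.choose_spec.2]
  obtain ⟨s, hs⟩ := hs
  have key := expect_ite_eqOn (T.image Prod.fst) s (fun h => φ (fun a b => h (a, b)))
    (fun h h' hh => hφ _ _ fun a b hab => hh (a, b) hab)
  rw [Finset.card_image_of_injOn hT, Fintype.card_fin] at key
  have e1 : (𝔼 f, φ f) = 𝔼 h : Fin n × Fin n → Fin n, φ (fun a b => h (a, b)) :=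
    (Fintype.expect_equiv (Equiv.curry (Fin n) (Fin n) (Fin n)) _ _ fun _ => rfl).symm
  rw [e1, ← key]
  refine (Fintype.expect_equiv (Equiv.curry (Fin n) (Fin n) (Fin n)) _ _ fun h => ?_).symm
  refine if_congr ?_ rfl rfl
  simp only [Agrees, Finset.forall_mem_image]
  refine forall₂_congr fun q hq => ?_
  rw [hs q hq]
  rfl

theorem prob_agrees [NeZero n] {T : Finset ((Fin n × Fin n) × Fin n)} (hT : Functional T) :
    prob (Agrees T) = (n : ℝ)⁻¹ ^ T.card := by
  rw [prob, expect_ite_agrees hT (fun _ => 1) (fun _ _ _ => rfl)]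
  simp

theorem prob_agrees_le [NeZero n] (T : Finset ((Fin n × Fin n) × Fin n)) :
    prob (Agrees T) ≤ (n : ℝ)⁻¹ ^ T.card := by
  by_cases h : ∃ f, Agrees T f
  · exact (prob_agrees h.choose_spec.functional).le
  · push Not at h
    simp only [prob, h]
    simp

theorem agrees_union {S T : Finset ((Fin n × Fin n) × Fin n)} {f : Rule n} :
    Agrees (S ∪ T) f ↔ Agrees S f ∧ Agrees T f := by
  simp only [Agrees, Finset.mem_union, or_imp, forall_and]

/-- The independence hypothesis of the Poisson approximation: the sets in `J` look at the rule only
away from the arguments in `T`. -/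
theorem expect_ite_agrees_occurrences [NeZero n] {T : Finset ((Fin n × Fin n) × Fin n)}
    (hT : Functional T) (J : Finset (Finset ((Fin n × Fin n) × Fin n)))
    (hJ : ∀ S ∈ J, Disjoint (T.image Prod.fst) (S.image Prod.fst)) (s : ℝ) :
    (𝔼 f, if Agrees T f then s ^ occurrences J Agrees f else 0) =
      prob (Agrees T) * 𝔼 f, s ^ occurrences J Agrees f := by
  rw [prob_agrees hT]
  refine expect_ite_agrees hT _ fun f f' hff' => ?_
  congr 1
  simp only [occurrences]
  congr 1
  refine Finset.filter_congr fun S hS => forall₂_congr fun q hq => ?_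
  rw [hff']
  exact fun h => Finset.disjoint_left.1 (hJ S hS) h (Finset.mem_image_of_mem _ hq)

/-- The values of the constraints in `T`. -/
def outputs (T : Finset ((Fin n × Fin n) × Fin n)) : Finset (Fin n) := T.image Prod.snd

theorem outputs_union (S T : Finset ((Fin n × Fin n) × Fin n)) :
    outputs (S ∪ T) = outputs S ∪ outputs T := Finset.image_union _ _

theorem card_outputs_le (T : Finset ((Fin n × Fin n) × Fin n)) : (outputs T).card ≤ T.card :=
  Finset.card_image_le

/-- Each size `k ≤ K` contributes at most `1`, as there are at most `n ^ k` sets of weight `n ^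
(-k)`. -/
theorem sum_powerset_card_le [NeZero n] (K : ℕ) :
    ∑ A : Finset (Fin n) with A.card ≤ K, (n : ℝ)⁻¹ ^ A.card ≤ K + 1 := by
  have hn : (n : ℝ) ≠ 0 := by exact_mod_cast NeZero.ne n
  have := Finset.sum_fiberwise_of_maps_to
    (s := Finset.univ.filter fun A : Finset (Fin n) => A.card ≤ K) (t := Finset.range (K + 1))
    (g := Finset.card) (by intro A hA; simp at hA ⊢; omega) (fun A => (n : ℝ)⁻¹ ^ A.card)
  rw [← this]
  refine (Finset.sum_le_card_nsmul _ _ 1 fun k hk => ?_).trans (by simp)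
  calc _ = ∑ A : Finset (Fin n) with A.card ≤ K ∧ A.card = k, (n : ℝ)⁻¹ ^ k := by
        rw [Finset.filter_filter]
        exact Finset.sum_congr rfl fun A hA => by rw [(Finset.mem_filter.1 hA).2.2]
    _ ≤ (n : ℝ) ^ k * (n : ℝ)⁻¹ ^ k := by
        rw [Finset.sum_const, nsmul_eq_mul]
        refine mul_le_mul_of_nonneg_right ?_ (by positivity)
        have : (Finset.univ.filter fun A : Finset (Fin n) => A.card ≤ K ∧ A.card = k).card ≤
            n.choose k := by
          calc _ ≤ (Finset.powersetCard k (Finset.univ : Finset (Fin n))).card := by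
                refine Finset.card_le_card fun A hA => ?_
                rw [Finset.mem_filter] at hA
                exact Finset.mem_powersetCard.2 ⟨Finset.subset_univ _, hA.2.2⟩
            _ = n.choose k := by simp
        exact_mod_cast this.trans (Nat.choose_le_pow n k)
    _ = 1 := by rw [← mul_pow, mul_inv_cancel₀ hn, one_pow]

/-- The pairs of constraint sets with at most `K` colours altogether, weighted by `n` to the power
of minus one more than the number of colours, have total weight `O(1 / n)`. -/
theorem sum_pairs_le [NeZero n] (K : ℕ)
    (Q : Finset (Finset ((Fin n × Fin n) × Fin n) × Finset ((Fin n × Fin n) × Fin n)))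
    (colours : Finset ((Fin n × Fin n) × Fin n) × Finset ((Fin n × Fin n) × Fin n) →
      Finset (Fin n))
    (hK : ∀ q ∈ Q, (colours q).card ≤ K)
    (h1 : ∀ q ∈ Q, q.1 ⊆ (colours q ×ˢ colours q) ×ˢ colours q)
    (h2 : ∀ q ∈ Q, q.2 ⊆ (colours q ×ˢ colours q) ×ˢ colours q) :
    ∑ q ∈ Q, (n : ℝ)⁻¹ ^ ((colours q).card + 1) ≤ (K + 1) * 4 ^ K ^ 3 * (n : ℝ)⁻¹ := by
  have hn : (0 : ℝ) ≤ (n : ℝ)⁻¹ := by positivity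
  have := Finset.sum_fiberwise_of_maps_to (s := Q)
    (t := Finset.univ.filter fun A : Finset (Fin n) => A.card ≤ K)
    (g := colours) (by intro q hq; simpa using hK q hq)
    (fun q => (n : ℝ)⁻¹ ^ ((colours q).card + 1))
  rw [← this]
  calc _ ≤ ∑ A : Finset (Fin n) with A.card ≤ K, 4 ^ K ^ 3 * (n : ℝ)⁻¹ * (n : ℝ)⁻¹ ^ A.card := by
        refine Finset.sum_le_sum fun A hA => ?_
        have hA' : A.card ≤ K := (Finset.mem_filter.1 hA).2
        calc _ = ∑ q ∈ Q with colours q = A, (n : ℝ)⁻¹ ^ (A.card + 1) :=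
              Finset.sum_congr rfl fun q hq => by rw [(Finset.mem_filter.1 hq).2]
          _ = ((Q.filter fun q => colours q = A).card : ℝ) * (n : ℝ)⁻¹ ^ (A.card + 1) := by
              rw [Finset.sum_const, nsmul_eq_mul]
          _ ≤ 4 ^ K ^ 3 * (n : ℝ)⁻¹ ^ (A.card + 1) := by
              refine mul_le_mul_of_nonneg_right ?_ (by positivity)
              -- With the colours `A` fixed, both members are subsets of `A × A × A`, so at most `4
              -- ^ (|A| ^ 3)` pairs remain, independently of `n`.
              have hsub : (Q.filter fun q => colours q = A) ⊆
                  ((A ×ˢ A) ×ˢ A).powerset ×ˢ ((A ×ˢ A) ×ˢ A).powerset := by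
                intro q hq
                obtain ⟨hqQ, rfl⟩ := Finset.mem_filter.1 hq
                simp only [Finset.mem_product, Finset.mem_powerset]
                exact ⟨h1 q hqQ, h2 q hqQ⟩
              have hc := Finset.card_le_card hsub
              rw [Finset.card_product, Finset.card_powerset, ← mul_pow] at hc
              simp only [Finset.card_product] at hc
              have : (2 * 2) ^ (A.card * A.card * A.card) ≤ 4 ^ K ^ 3 := by
                refine Nat.pow_le_pow_right (by norm_num) ?_
                calc A.card * A.card * A.card ≤ K * K * K := by gcongr
                  _ = K ^ 3 := by ring
              exact_mod_cast hc.trans this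
          _ = _ := by ring
    _ ≤ _ := by
        rw [← Finset.mul_sum]
        calc _ ≤ 4 ^ K ^ 3 * (n : ℝ)⁻¹ * (K + 1) :=
              mul_le_mul_of_nonneg_left (sum_powerset_card_le K) (by positivity)
          _ = _ := by ring

end LocalEvents

/-! ### Doubly periodic patterns and the rigidity of simple ones -/

section Tiles

variable {n τ σ σ' : ℕ} [NeZero τ] [NeZero σ] [NeZero σ']

/-- The constraints on a rule under which the doubly periodic pattern `u` is one of its
space-time configurations. -/
noncomputable def constraints (u : ZMod τ × ZMod σ → Fin n) : Finset ((Fin n × Fin n) × Fin n) :=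
  Finset.univ.image fun p => ((u (p - (1, 1)), u (p - (1, 0))), u p)

/-- The temporal and spatial periods of `u` are exactly `τ` and `σ`. -/
def IsMinimal (u : ZMod τ × ZMod σ → Fin n) : Prop :=
  (∀ t, (∀ p, u (p + (t, 0)) = u p) → t = 0) ∧ (∀ x, (∀ p, u (p + (0, x)) = u p) → x = 0)

/-- No two constraints have the same value. -/
def IsSimple (T : Finset ((Fin n × Fin n) × Fin n)) : Prop :=
  Set.InjOn Prod.snd (T : Set ((Fin n × Fin n) × Fin n))

theorem isSimple_iff_card {T : Finset ((Fin n × Fin n) × Fin n)} :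
    IsSimple T ↔ (outputs T).card = T.card := Finset.card_image_iff.symm

theorem card_outputs_lt {T : Finset ((Fin n × Fin n) × Fin n)} (h : ¬ IsSimple T) :
    (outputs T).card + 1 ≤ T.card :=
  lt_of_le_of_ne (card_outputs_le T) (fun h' => h (isSimple_iff_card.2 h'))

theorem IsSimple.mono {S T : Finset ((Fin n × Fin n) × Fin n)} (hT : IsSimple T) (h : S ⊆ T) :
    IsSimple S := Set.InjOn.mono (by exact_mod_cast h) hT

theorem mem_constraints (u : ZMod τ × ZMod σ → Fin n) (p : ZMod τ × ZMod σ) :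
    ((u (p - (1, 1)), u (p - (1, 0))), u p) ∈ constraints u :=
  Finset.mem_image_of_mem _ (Finset.mem_univ p)

theorem outputs_constraints (u : ZMod τ × ZMod σ → Fin n) :
    outputs (constraints u) = Finset.univ.image u := by
  rw [outputs, constraints, Finset.image_image]
  rfl

theorem mem_outputs_constraints (u : ZMod τ × ZMod σ → Fin n) (p : ZMod τ × ZMod σ) :
    u p ∈ outputs (constraints u) := by
  rw [outputs_constraints]
  exact Finset.mem_image_of_mem _ (Finset.mem_univ p)

theorem constraints_subset_product (u : ZMod τ × ZMod σ → Fin n) {A : Finset (Fin n)}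
    (hA : outputs (constraints u) ⊆ A) : constraints u ⊆ (A ×ˢ A) ×ˢ A := by
  intro q hq
  obtain ⟨p, -, rfl⟩ := Finset.mem_image.1 hq
  simp only [Finset.mem_product]
  exact ⟨⟨hA (mem_outputs_constraints u _), hA (mem_outputs_constraints u _)⟩,
    hA (mem_outputs_constraints u _)⟩

theorem card_outputs_constraints_le (u : ZMod τ × ZMod σ → Fin n) :
    (outputs (constraints u)).card ≤ τ * σ := by
  rw [outputs_constraints]
  refine Finset.card_image_le.trans ?_
  simp [ZMod.card]

theorem constraints_nonempty (u : ZMod τ × ZMod σ → Fin n) : (constraints u).Nonempty :=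
  ⟨_, mem_constraints u 0⟩

theorem constraints_translate (u : ZMod τ × ZMod σ → Fin n) (g : ZMod τ × ZMod σ) :
    constraints (fun p => u (p + g)) = constraints u := by
  ext q
  simp only [constraints, Finset.mem_image, Finset.mem_univ, true_and]
  constructor
  · rintro ⟨p, rfl⟩
    exact ⟨p + g, by simp only [sub_add_eq_add_sub]⟩
  · rintro ⟨p, rfl⟩
    exact ⟨p - g, by simp [sub_add_eq_add_sub]⟩

omit [NeZero τ] [NeZero σ] in
theorem IsMinimal.translate {u : ZMod τ × ZMod σ → Fin n} (hu : IsMinimal u)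
    (g : ZMod τ × ZMod σ) : IsMinimal (fun p => u (p + g)) := by
  refine ⟨fun t ht => hu.1 t fun p => ?_, fun x hx => hu.2 x fun p => ?_⟩
  · simpa [sub_add_eq_add_sub] using ht (p - g)
  · simpa [sub_add_eq_add_sub] using hx (p - g)

/-- The point of the torus below a point of the plane. -/
def proj (τ σ : ℕ) (i j : ℤ) : ZMod τ × ZMod σ := (i, j)

omit [NeZero τ] [NeZero σ] in
theorem proj_surjective (p : ZMod τ × ZMod σ) : ∃ i j : ℤ, proj τ σ i j = p := by
  obtain ⟨i, hi⟩ := ZMod.intCast_surjective p.1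
  obtain ⟨j, hj⟩ := ZMod.intCast_surjective p.2
  exact ⟨i, j, Prod.ext hi hj⟩

omit [NeZero τ] [NeZero σ] in
theorem proj_add (i j k l : ℤ) : proj τ σ (i + k) (j + l) = proj τ σ i j + proj τ σ k l := by
  simp [proj]

/-- When each value determines its constraint, two patterns that agree at one point agree
everywhere. -/
theorem eq_of_eq_at {u : ZMod τ × ZMod σ → Fin n} {u' : ZMod τ × ZMod σ' → Fin n}
    (hT : IsSimple (constraints u ∪ constraints u')) {p : ZMod τ × ZMod σ}
    {p' : ZMod τ × ZMod σ'} (h : u p = u' p') (i j : ℤ) :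
    u (p + proj τ σ i j) = u' (p' + proj τ σ' i j) := by
  have hstep : ∀ q q', u q = u' q' →
      u (q - (1, 1)) = u' (q' - (1, 1)) ∧ u (q - (1, 0)) = u' (q' - (1, 0)) := by
    intro q q' hq
    have := hT (Finset.mem_union_left _ (mem_constraints u q))
      (Finset.mem_union_right _ (mem_constraints u' q')) hq
    simpa [Prod.ext_iff] using congrArg Prod.fst this
  -- Parents lie at the offsets `(-1, 0)` and `(-1, -1)`; `k` steps of the first kind and `l` of the
  -- second reach `(-(k + l), -l)`.
  have hk : ∀ k : ℕ, u (p + proj τ σ (-k) 0) = u' (p' + proj τ σ' (-k) 0) := by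
    intro k
    induction k with
    | zero => simpa [proj, ← Prod.zero_eq_mk] using h
    | succ k ih =>
      convert (hstep _ _ ih).2 using 2 <;> simp [proj, Prod.ext_iff] <;> ring
  have hkl : ∀ k l : ℕ, u (p + proj τ σ (-(k + l)) (-l)) =
      u' (p' + proj τ σ' (-(k + l)) (-l)) := by
    intro k l
    induction l with
    | zero => simpa using hk k
    | succ l ih =>
      convert (hstep _ _ ih).1 using 2 <;> simp [proj, Prod.ext_iff] <;> constructor <;> ring
  -- A common multiple of all the periods: modulo `N`, every `(i, j)` has the form `(-(k + l), -l)`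
  -- on both tori at once.
  set N : ℕ := τ * σ * σ' with hN
  have hNpos : 0 < N := Nat.pos_of_ne_zero
    (mul_ne_zero (mul_ne_zero (NeZero.ne τ) (NeZero.ne σ)) (NeZero.ne σ'))
  have hl : ∀ m : ℤ, ∃ l : ℕ, (N : ℤ) ∣ m + l := by
    intro m
    refine ⟨((-m) % N).toNat, ?_⟩
    rw [Int.toNat_of_nonneg (Int.emod_nonneg _ (by exact_mod_cast hNpos.ne'))]
    have := Int.dvd_self_sub_emod (x := -m) (m := N)
    rw [← dvd_neg]
    rwa [show -(m + -m % (N : ℤ)) = -m - -m % (N : ℤ) by ring]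
  obtain ⟨l, hl'⟩ := hl j
  obtain ⟨k, hk'⟩ := hl (i + l)
  have cast_eq : ∀ (M : ℕ) (x y : ℤ), M ∣ N → (N : ℤ) ∣ x - y → (x : ZMod M) = y := by
    intro M x y hM hxy
    rw [← sub_eq_zero, ← Int.cast_sub, ZMod.intCast_zmod_eq_zero_iff_dvd]
    exact (Int.natCast_dvd_natCast.2 hM).trans hxy
  have d1 : (N : ℤ) ∣ i - -(k + l) := by convert hk' using 1; ring
  have d2 : (N : ℤ) ∣ j - -l := by convert hl' using 1; ring
  have e : proj τ σ i j = proj τ σ (-(k + l)) (-l) :=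
    Prod.ext (cast_eq τ _ _ ⟨σ * σ', by rw [hN]; ring⟩ d1)
      (cast_eq σ _ _ ⟨τ * σ', by rw [hN]; ring⟩ d2)
  have e' : proj τ σ' i j = proj τ σ' (-(k + l)) (-l) :=
    Prod.ext (cast_eq τ _ _ ⟨σ * σ', by rw [hN]; ring⟩ d1)
      (cast_eq σ' _ _ ⟨τ * σ, by rw [hN]; ring⟩ d2)
  rw [e, e']
  exact hkl k l

theorem IsSimple.eq_add {u : ZMod τ × ZMod σ → Fin n} (hu : IsSimple (constraints u))
    {p q : ZMod τ × ZMod σ} (h : u p = u q) (v : ZMod τ × ZMod σ) : u (p + v) = u (q + v) := by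
  obtain ⟨i, j, rfl⟩ := proj_surjective v
  exact eq_of_eq_at (u := u) (u' := u) (by rwa [Finset.union_self]) h i j

/-- Equal arguments include equal states at the sites `p - (1, 0)` and `q - (1, 0)`; rigidity
carries this equality one time step forward to the values. -/
theorem IsSimple.functional {u : ZMod τ × ZMod σ → Fin n} (hu : IsSimple (constraints u)) :
    Functional (constraints u) := by
  intro c hc d hd hcd
  obtain ⟨p, -, rfl⟩ := Finset.mem_image.1 hc
  obtain ⟨q, -, rfl⟩ := Finset.mem_image.1 hd
  refine Prod.ext hcd ?_
  have := hu.eq_add (congrArg Prod.snd hcd) (1, 0)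
  simpa using this

-- A spatial shift by `σ` fixes `u`, hence also `u'`, and minimality of `u'` makes it zero in `ZMod
-- σ'`.
omit [NeZero τ] [NeZero σ] [NeZero σ'] in
theorem period_dvd {u : ZMod τ × ZMod σ → Fin n} {u' : ZMod τ × ZMod σ' → Fin n}
    (hu' : IsMinimal u') {p : ZMod τ × ZMod σ} {p' : ZMod τ × ZMod σ'}
    (h : ∀ i j, u (p + proj τ σ i j) = u' (p' + proj τ σ' i j)) : σ' ∣ σ := by
  rw [← ZMod.natCast_eq_zero_iff]
  refine hu'.2 _ fun q => ?_
  obtain ⟨i, j, hq⟩ := proj_surjective (q - p')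
  have e : q = p' + proj τ σ' i j := by rw [hq]; abel
  have e2 : (0, (σ : ZMod σ')) = proj τ σ' 0 σ := by simp [proj]
  have e3 : proj τ σ 0 σ = 0 := by simp [proj]
  rw [e, add_assoc, e2, ← proj_add, ← h, ← h, proj_add, e3, add_zero]

/-- Two minimal patterns with a common state whose joint constraints are determined by their values
have the same constraints and the same spatial period. -/
theorem constraints_eq_of_not_disjoint {u : ZMod τ × ZMod σ → Fin n}
    {u' : ZMod τ × ZMod σ' → Fin n} (hu : IsMinimal u) (hu' : IsMinimal u')
    (hT : IsSimple (constraints u ∪ constraints u'))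
    (h : ¬ Disjoint (outputs (constraints u)) (outputs (constraints u'))) :
    constraints u = constraints u' ∧ σ = σ' := by
  rw [outputs_constraints, outputs_constraints, Finset.not_disjoint_iff] at h
  obtain ⟨c, hc, hc'⟩ := h
  obtain ⟨p, -, rfl⟩ := Finset.mem_image.1 hc
  obtain ⟨p', -, hpp'⟩ := Finset.mem_image.1 hc'
  have key := eq_of_eq_at hT hpp'.symm
  obtain rfl : σ = σ' := Nat.dvd_antisymm
    (period_dvd hu fun i j => (key i j).symm) (period_dvd hu' key)
  refine ⟨?_, rfl⟩
  rw [← constraints_translate u p, ← constraints_translate u' p']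
  congr 1
  ext v
  obtain ⟨i, j, rfl⟩ := proj_surjective v
  rw [add_comm, key, add_comm]

theorem not_disjoint_outputs {u : ZMod τ × ZMod σ → Fin n} {u' : ZMod τ × ZMod σ' → Fin n}
    (h : ¬ Disjoint ((constraints u).image Prod.fst) ((constraints u').image Prod.fst)) :
    ¬ Disjoint (outputs (constraints u)) (outputs (constraints u')) := by
  rw [Finset.not_disjoint_iff] at h ⊢
  obtain ⟨c, hc, hc'⟩ := h
  obtain ⟨q, hq, rfl⟩ := Finset.mem_image.1 hc
  obtain ⟨q', hq', hqq'⟩ := Finset.mem_image.1 hc'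
  obtain ⟨p, -, rfl⟩ := Finset.mem_image.1 hq
  obtain ⟨p', -, rfl⟩ := Finset.mem_image.1 hq'
  refine ⟨u (p - (1, 0)), mem_outputs_constraints u _, ?_⟩
  have h2 : u' (p' - (1, 0)) = u (p - (1, 0)) := congrArg Prod.snd hqq'
  rw [← h2]
  exact mem_outputs_constraints u' _

end Tiles

/-! ### Periodic solutions as patterns on a torus -/

section Bridge

variable {n τ σ : ℕ}

theorem trajectory_succ (f : Rule n) (ξ : Config n) (t : ℕ) (x : ℤ) :
    trajectory f ξ (t + 1) x = f (trajectory f ξ t (x - 1)) (trajectory f ξ t x) := by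
  rw [trajectory, Function.iterate_succ_apply']
  rfl

theorem trajectory_periodic_space {f : Rule n} {ξ : Config n} {s : ℤ}
    (h : ∀ x, ξ (x + s) = ξ x) (t : ℕ) (x : ℤ) :
    trajectory f ξ t (x + s) = trajectory f ξ t x := by
  induction t generalizing x with
  | zero => exact h x
  | succ t ih => rw [trajectory_succ, trajectory_succ, ih, ← ih (x - 1), sub_add_eq_add_sub]

theorem trajectory_periodic_time {f : Rule n} {ξ : Config n} {s : ℕ}
    (h : ∀ x, trajectory f ξ s x = ξ x) (t : ℕ) :
    trajectory f ξ (t + s) = trajectory f ξ t := by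
  have : (step f)^[s] ξ = ξ := funext h
  rw [trajectory, Function.iterate_add_apply, this]
  rfl

variable [NeZero τ] [NeZero σ]

theorem agrees_constraints {f : Rule n} {u : ZMod τ × ZMod σ → Fin n} :
    Agrees (constraints u) f ↔ ∀ p, f (u (p - (1, 1))) (u (p - (1, 0))) = u p := by
  simp only [Agrees, constraints, Finset.forall_mem_image, Finset.mem_univ, true_imp_iff]

theorem trajectory_eq_of_agrees {f : Rule n} {u : ZMod τ × ZMod σ → Fin n}
    (h : Agrees (constraints u) f) (t : ℕ) (x : ℤ) :
    trajectory f (fun x => u (0, x)) t x = u (t, x) := by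
  induction t generalizing x with
  | zero => simp [trajectory]
  | succ t ih =>
    rw [trajectory_succ, ih, ih, ← agrees_constraints.1 h (((t + 1 : ℕ) : ZMod τ), (x : ZMod σ))]
    simp

theorem periodicSolutions_nonempty_of_agrees {f : Rule n} {u : ZMod τ × ZMod σ → Fin n}
    (hu : IsMinimal u) (h : Agrees (constraints u) f) : (periodicSolutions f τ σ).Nonempty := by
  refine ⟨fun x => u (0, x), ⟨⟨Nat.pos_of_ne_zero (NeZero.ne σ), by simp⟩, ?_⟩,
    ⟨⟨Nat.pos_of_ne_zero (NeZero.ne τ), fun x => ?_⟩, ?_⟩⟩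
  · rintro s ⟨hs, hper⟩
    refine Nat.le_of_dvd hs ((ZMod.natCast_eq_zero_iff _ _).1 (hu.2 _ fun p => ?_))
    obtain ⟨t, ht⟩ := ZMod.natCast_zmod_surjective p.1
    obtain ⟨x, hx⟩ := ZMod.intCast_surjective p.2
    have := trajectory_periodic_space (f := f) (ξ := fun x : ℤ => u (0, (x : ZMod σ))) hper t x
    rw [trajectory_eq_of_agrees h, trajectory_eq_of_agrees h] at this
    have e : p = (↑t, ↑x) := Prod.ext ht.symm hx.symm
    rw [e]
    simpa using this
  · rw [trajectory_eq_of_agrees h]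
    simp
  · rintro s ⟨hs, hper⟩
    refine Nat.le_of_dvd hs ((ZMod.natCast_eq_zero_iff _ _).1 (hu.1 _ fun p => ?_))
    obtain ⟨t, ht⟩ := ZMod.natCast_zmod_surjective p.1
    obtain ⟨x, hx⟩ := ZMod.intCast_surjective p.2
    have := congrFun (trajectory_periodic_time hper t) x
    rw [trajectory_eq_of_agrees h, trajectory_eq_of_agrees h] at this
    have e : p = (↑t, ↑x) := Prod.ext ht.symm hx.symm
    rw [e]
    simpa using this

theorem exists_agrees_of_mem_periodicSolutions {f : Rule n} {ξ : Config n}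
    (hξ : ξ ∈ periodicSolutions f τ σ) :
    ∃ u : ZMod τ × ZMod σ → Fin n, IsMinimal u ∧ Agrees (constraints u) f := by
  obtain ⟨⟨⟨-, hσ⟩, hσ'⟩, ⟨⟨-, hτ⟩, hτ'⟩⟩ := hξ
  -- The space-time configuration is read off at canonical representatives; `key` shows that any
  -- representatives would do.
  set u : ZMod τ × ZMod σ → Fin n := fun p => trajectory f ξ p.1.val (p.2.val : ℤ) with hu
  have key : ∀ (t : ℕ) (x : ℤ), u (t, x) = trajectory f ξ t x := by
    intro t x
    have h1 : trajectory f ξ (t % τ) = trajectory f ξ t := by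
      have : Function.IsPeriodicPt (step f) τ ξ := funext hτ
      exact this.iterate_mod_apply t
    have h2 : Function.Periodic (trajectory f ξ t) (σ : ℤ) := trajectory_periodic_space hσ t
    simp only [hu, ZMod.val_natCast, ZMod.val_intCast, h1]
    conv_rhs => rw [← Int.emod_add_mul_ediv x σ, mul_comm]
    exact (h2.int_mul _ _).symm
  have key0 : ∀ x : ℤ, u (0, x) = ξ x := fun x => by simpa [trajectory] using key 0 x
  refine ⟨u, ⟨fun t ht => ?_, fun x hx => ?_⟩, agrees_constraints.2 fun p => ?_⟩
  · by_contra hne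
    have hpos : 0 < t.val := Nat.pos_of_ne_zero fun h => hne ((ZMod.val_eq_zero t).1 h)
    refine absurd (hτ' ⟨hpos, fun x => ?_⟩) (not_le.2 (ZMod.val_lt t))
    rw [← key, ← key0, ← ht (0, x)]
    simp
  · by_contra hne
    have hpos : 0 < x.val := Nat.pos_of_ne_zero fun h => hne ((ZMod.val_eq_zero x).1 h)
    refine absurd (hσ' ⟨hpos, fun y => ?_⟩) (not_le.2 (ZMod.val_lt x))
    rw [← key0, ← key0, ← hx (0, y)]
    simp
  · obtain ⟨t, ht⟩ := ZMod.natCast_zmod_surjective (p.1 - 1)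
    obtain ⟨x, hx⟩ := ZMod.intCast_surjective p.2
    have e : p = (((t + 1 : ℕ) : ZMod τ), (x : ZMod σ)) := Prod.ext (by simp [ht]) hx.symm
    have e1 : p - (1, 1) = ((t : ZMod τ), ((x - 1 : ℤ) : ZMod σ)) :=
      Prod.ext ht.symm (by simp [hx])
    have e2 : p - (1, 0) = ((t : ZMod τ), (x : ZMod σ)) := Prod.ext ht.symm (by simp [hx])
    rw [e1, e2, e, key, key, key, trajectory_succ]

omit [NeZero σ] in
theorem smallestSpatialPeriod_le_iff {f : Rule n} {y : ℕ} :
    smallestSpatialPeriod τ f ≤ (y : ℕ∞) ↔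
      ∃ k < y, ∃ u : ZMod τ × ZMod (k + 1) → Fin n, IsMinimal u ∧ Agrees (constraints u) f := by
  constructor
  · intro h
    by_contra hcon
    push Not at hcon
    have : ((y + 1 : ℕ) : ℕ∞) ≤ smallestSpatialPeriod τ f := by
      refine le_iInf₂ fun σ hσ => ?_
      obtain ⟨ξ, hξ⟩ := hσ
      have hpos : 0 < σ := hξ.1.1.1
      obtain ⟨k, rfl⟩ : ∃ k, σ = k + 1 := ⟨σ - 1, by omega⟩
      obtain ⟨u, hu, hu'⟩ := exists_agrees_of_mem_periodicSolutions hξ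
      by_contra hlt
      have : k < y := by
        rw [Nat.cast_le] at hlt
        omega
      exact hcon k this u hu hu'
    have h2 := this.trans h
    rw [Nat.cast_le] at h2
    omega
  · rintro ⟨k, hk, u, hu, hu'⟩
    refine (iInf₂_le (k + 1) (periodicSolutions_nonempty_of_agrees hu hu')).trans ?_
    exact_mod_cast hk

theorem uniformRule_real_eq_prob (P : Rule n → Prop) :
    (uniformRule n).real {f | P f} = prob P := by
  rw [Measure.real, uniformRule, PMF.toMeasure_uniformOfFintype_apply _
    (Set.toFinite _).measurableSet, prob, Fintype.expect_eq_sum_div_card, Finset.sum_boole,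
    ENNReal.toReal_div]
  simp [Fintype.card_subtype]

end Bridge

/-! ### The distribution function up to `O(1 / n)` -/

section Approximation

/-- The minimal patterns with exactly as many states as constraints. -/
noncomputable def simplePatterns (n τ σ : ℕ) [NeZero τ] [NeZero σ] :
    Finset (ZMod τ × ZMod σ → Fin n) :=
  Finset.univ.filter fun u => IsMinimal u ∧ IsSimple (constraints u)

/-- The constraint sets of the simple patterns of spatial period at most `y`. -/
noncomputable def simpleSets (n τ y : ℕ) [NeZero τ] :
    Finset (Finset ((Fin n × Fin n) × Fin n)) :=
  (Finset.range y).biUnion fun k => (simplePatterns n τ (k + 1)).image constraints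

/-- The constraint sets of the other minimal patterns of spatial period at most `y`. -/
noncomputable def nonsimpleSets (n τ y : ℕ) [NeZero τ] :
    Finset (Finset ((Fin n × Fin n) × Fin n)) :=
  Finset.univ.filter fun T => ¬ IsSimple T ∧
    ∃ k < y, ∃ u : ZMod τ × ZMod (k + 1) → Fin n, IsMinimal u ∧ constraints u = T

/-- The two constraint sets restrict the value of the rule at a common argument. -/
def Overlap {n : ℕ} (S T : Finset ((Fin n × Fin n) × Fin n)) : Prop :=
  ¬ Disjoint (S.image Prod.fst) (T.image Prod.fst)

variable {n τ y : ℕ} [NeZero τ]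

theorem mem_simpleSets {S : Finset ((Fin n × Fin n) × Fin n)} :
    S ∈ simpleSets n τ y ↔ ∃ k < y, ∃ u : ZMod τ × ZMod (k + 1) → Fin n,
      (IsMinimal u ∧ IsSimple (constraints u)) ∧ constraints u = S := by
  simp [simpleSets, simplePatterns]

theorem smallestSpatialPeriod_le_iff_exists {f : Rule n} :
    smallestSpatialPeriod τ f ≤ (y : ℕ∞) ↔
      (∃ S ∈ simpleSets n τ y, Agrees S f) ∨ ∃ T ∈ nonsimpleSets n τ y, Agrees T f := by
  rw [smallestSpatialPeriod_le_iff]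
  constructor
  · rintro ⟨k, hk, u, hu, hf⟩
    by_cases hs : IsSimple (constraints u)
    · exact Or.inl ⟨_, mem_simpleSets.2 ⟨k, hk, u, ⟨hu, hs⟩, rfl⟩, hf⟩
    · exact Or.inr ⟨_, Finset.mem_filter.2 ⟨Finset.mem_univ _, hs, k, hk, u, hu, rfl⟩, hf⟩
  · rintro (⟨S, hS, hf⟩ | ⟨T, hT, hf⟩)
    · obtain ⟨k, hk, u, ⟨hu, -⟩, rfl⟩ := mem_simpleSets.1 hS
      exact ⟨k, hk, u, hu, hf⟩
    · obtain ⟨-, -, k, hk, u, hu, rfl⟩ := Finset.mem_filter.1 hT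
      exact ⟨k, hk, u, hu, hf⟩

theorem sum_nonsimpleSets_le [NeZero n] :
    ∑ T ∈ nonsimpleSets n τ y, prob (Agrees T) ≤
      ((τ * y : ℕ) + 1) * 4 ^ (τ * y) ^ 3 * (n : ℝ)⁻¹ := by
  have hn : (n : ℝ)⁻¹ ≤ 1 := inv_le_one_of_one_le₀ (by exact_mod_cast NeZero.one_le)
  -- A single set is treated as the pair `(T, T)`, so that the bound for pairs applies.
  have key := sum_pairs_le (n := n) (τ * y)
    ((nonsimpleSets n τ y).image fun T => (T, T)) (fun q => outputs q.1)
  rw [Finset.sum_image (by intro a _ b _ h; exact congrArg Prod.fst h)] at key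
  have hsub : ∀ T ∈ nonsimpleSets n τ y, (outputs T).card ≤ τ * y ∧
      T ⊆ (outputs T ×ˢ outputs T) ×ˢ outputs T := by
    intro T hT
    obtain ⟨-, -, k, hk, u, hu, rfl⟩ := Finset.mem_filter.1 hT
    exact ⟨(card_outputs_constraints_le u).trans (Nat.mul_le_mul_left _ hk),
      constraints_subset_product u subset_rfl⟩
  refine le_trans (Finset.sum_le_sum fun T hT => ?_) (key ?_ ?_ ?_)
  · refine (prob_agrees_le T).trans (pow_le_pow_of_le_one (by positivity) hn ?_)
    exact card_outputs_lt (Finset.mem_filter.1 hT).2.1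
  all_goals
    rw [Finset.forall_mem_image]
    intro T hT
    first | exact (hsub T hT).1 | exact (hsub T hT).2

theorem sum_overlap_le [NeZero n] (w : Finset ((Fin n × Fin n) × Fin n) →
      Finset ((Fin n × Fin n) × Fin n) → ℝ)
    (r : Finset ((Fin n × Fin n) × Fin n) → Finset ((Fin n × Fin n) × Fin n) → Prop)
    (hw : ∀ S ∈ simpleSets n τ y, ∀ T ∈ simpleSets n τ y, r S T →
      w S T ≤ (n : ℝ)⁻¹ ^ ((outputs S ∪ outputs T).card + 1)) :
    ∑ S ∈ simpleSets n τ y, ∑ T ∈ simpleSets n τ y with r S T, w S T ≤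
      ((2 * (τ * y) : ℕ) + 1) * 4 ^ (2 * (τ * y)) ^ 3 * (n : ℝ)⁻¹ := by
  have key := sum_pairs_le (n := n) (2 * (τ * y))
    ((simpleSets n τ y ×ˢ simpleSets n τ y).filter fun q => r q.1 q.2)
    (fun q => outputs q.1 ∪ outputs q.2)
  have hsub : ∀ T ∈ simpleSets n τ y, (outputs T).card ≤ τ * y ∧
      ∀ A, outputs T ⊆ A → T ⊆ (A ×ˢ A) ×ˢ A := by
    intro T hT
    obtain ⟨k, hk, u, hu, rfl⟩ := mem_simpleSets.1 hT
    exact ⟨(card_outputs_constraints_le u).trans (Nat.mul_le_mul_left _ hk),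
      fun A => constraints_subset_product u⟩
  have hmem : ∀ q ∈ (simpleSets n τ y ×ˢ simpleSets n τ y).filter (fun q => r q.1 q.2),
      q.1 ∈ simpleSets n τ y ∧ q.2 ∈ simpleSets n τ y ∧ r q.1 q.2 := by
    intro q hq
    simpa [and_assoc] using hq
  refine le_trans ?_ (key ?_ ?_ ?_)
  · simp only [Finset.sum_filter]
    rw [Finset.sum_product]
    refine Finset.sum_le_sum fun S hS => Finset.sum_le_sum fun T hT => ?_
    split_ifs with h
    · exact hw S hS T hT h
    · exact le_rfl
  · intro q hq
    obtain ⟨h1, h2, -⟩ := hmem q hq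
    have := Finset.card_union_le (outputs q.1) (outputs q.2)
    have := (hsub _ h1).1
    have := (hsub _ h2).1
    omega
  · intro q hq
    exact (hsub _ (hmem q hq).1).2 _ Finset.subset_union_left
  · intro q hq
    exact (hsub _ (hmem q hq).2.1).2 _ Finset.subset_union_right

/-- A common argument forces a common state, so the union of the colour sets is smaller by at least
one than the total number of constraints. -/
theorem prob_agrees_mul_le [NeZero n] {S T : Finset ((Fin n × Fin n) × Fin n)}
    (hS : S ∈ simpleSets n τ y) (hT : T ∈ simpleSets n τ y) (h : Overlap S T) :
    prob (Agrees S) * prob (Agrees T) ≤ (n : ℝ)⁻¹ ^ ((outputs S ∪ outputs T).card + 1) := by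
  have hn : (n : ℝ)⁻¹ ≤ 1 := inv_le_one_of_one_le₀ (by exact_mod_cast NeZero.one_le)
  refine (mul_le_mul (prob_agrees_le S) (prob_agrees_le T) (prob_nonneg _)
    (by positivity)).trans ?_
  rw [← pow_add]
  refine pow_le_pow_of_le_one (by positivity) hn ?_
  obtain ⟨k, -, u, ⟨-, -⟩, rfl⟩ := mem_simpleSets.1 hS
  obtain ⟨k', -, u', ⟨-, -⟩, rfl⟩ := mem_simpleSets.1 hT
  have h1 := Finset.card_union_add_card_inter (outputs (constraints u)) (outputs (constraints u'))
  have h2 : 0 < (outputs (constraints u) ∩ outputs (constraints u')).card :=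
    Finset.card_pos.2 (Finset.not_disjoint_iff_nonempty_inter.1 (not_disjoint_outputs h))
  have h3 := card_outputs_le (constraints u)
  have h4 := card_outputs_le (constraints u')
  omega

/-- If the union were simple, rigidity would make the two sets equal; so it has at least one more
constraint than colours. -/
theorem prob_agrees_and_le [NeZero n] {S T : Finset ((Fin n × Fin n) × Fin n)}
    (hS : S ∈ simpleSets n τ y) (hT : T ∈ simpleSets n τ y) (h : Overlap S T ∧ T ≠ S) :
    prob (fun f => Agrees S f ∧ Agrees T f) ≤
      (n : ℝ)⁻¹ ^ ((outputs S ∪ outputs T).card + 1) := by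
  have hn : (n : ℝ)⁻¹ ≤ 1 := inv_le_one_of_one_le₀ (by exact_mod_cast NeZero.one_le)
  simp only [← agrees_union]
  refine (prob_agrees_le (S ∪ T)).trans (pow_le_pow_of_le_one (by positivity) hn ?_)
  rw [← outputs_union]
  refine card_outputs_lt fun hsimple => h.2 ?_
  obtain ⟨k, -, u, ⟨hu, -⟩, rfl⟩ := mem_simpleSets.1 hS
  obtain ⟨k', -, u', ⟨hu', -⟩, rfl⟩ := mem_simpleSets.1 hT
  exact (constraints_eq_of_not_disjoint hu hu' hsimple (not_disjoint_outputs h.1)).1.symm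

/-- The distribution function of the smallest spatial period, up to an error of order `1 / n`. -/
theorem abs_prob_smallestSpatialPeriod_le_sub [NeZero n] :
    |prob (fun f : Rule n => smallestSpatialPeriod τ f ≤ (y : ℕ∞)) -
        (1 - Real.exp (-∑ S ∈ simpleSets n τ y, (n : ℝ)⁻¹ ^ S.card))| ≤
      (2 * (((2 * (τ * y) : ℕ) + 1) * 4 ^ (2 * (τ * y)) ^ 3) +
        ((τ * y : ℕ) + 1) * 4 ^ (τ * y) ^ 3) * (n : ℝ)⁻¹ := by
  have hfun : ∀ S ∈ simpleSets n τ y, Functional S := by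
    intro S hS
    obtain ⟨k, -, u, ⟨-, hu⟩, rfl⟩ := mem_simpleSets.1 hS
    exact hu.functional
  have hpois := abs_prob_forall_not_sub_exp_le (simpleSets n τ y) (Agrees (n := n)) Overlap
    (fun S hS => by
      obtain ⟨k, -, u, -, rfl⟩ := mem_simpleSets.1 hS
      rw [Overlap, disjoint_self]
      exact ((constraints_nonempty u).image _).ne_empty)
    (fun S hS s => expect_ite_agrees_occurrences (hfun S hS) _
      (fun T hT => by
        have h := (Finset.mem_filter.1 hT).2
        exact not_not.1 h) s)
  have b1 := sum_overlap_le (n := n) (τ := τ) (y := y) _ Overlap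
    fun S hS T hT h => prob_agrees_mul_le hS hT h
  have b2 := sum_overlap_le (n := n) (τ := τ) (y := y) _ (fun S T => Overlap S T ∧ T ≠ S)
    fun S hS T hT h => prob_agrees_and_le hS hT h
  have b3 := (prob_exists_le (nonsimpleSets n τ y) (Agrees (n := n))).trans sum_nonsimpleSets_le
  rw [Finset.sum_congr rfl fun S hS => prob_agrees (hfun S hS)] at hpois
  have hnot : prob (fun f : Rule n => ∀ S ∈ simpleSets n τ y, ¬ Agrees S f) =
      1 - prob (fun f : Rule n => ∃ S ∈ simpleSets n τ y, Agrees S f) := by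
    rw [← prob_not]
    push Not
    rfl
  rw [hnot] at hpois
  have l1 : prob (fun f : Rule n => ∃ S ∈ simpleSets n τ y, Agrees S f) ≤
      prob (fun f : Rule n => smallestSpatialPeriod τ f ≤ (y : ℕ∞)) :=
    prob_mono fun f hf => smallestSpatialPeriod_le_iff_exists.2 (Or.inl hf)
  have l2 : prob (fun f : Rule n => smallestSpatialPeriod τ f ≤ (y : ℕ∞)) ≤
      prob (fun f : Rule n => ∃ S ∈ simpleSets n τ y, Agrees S f) +
        prob (fun f : Rule n => ∃ T ∈ nonsimpleSets n τ y, Agrees T f) :=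
    (prob_mono fun f hf => smallestSpatialPeriod_le_iff_exists.1 hf).trans (prob_or_le _ _)
  have hpois' := abs_le.1 (hpois.trans (add_le_add b1 (le_of_eq_of_le (by congr!) b2)))
  rw [abs_le]
  constructor <;> linarith [hpois'.1, hpois'.2, prob_nonneg
    (fun f : Rule n => ∃ T ∈ nonsimpleSets n τ y, Agrees T f)]

end Approximation

/-! ### Counting transverse subgroups -/

section TransverseSubgroups

variable {τ σ : ℕ}

/-- The subgroup meets both coordinate axes only in the origin. -/
def Transverse (H : AddSubgroup (ZMod τ × ZMod σ)) : Prop :=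
  (∀ t, (t, 0) ∈ H → t = 0) ∧ (∀ x, (0, x) ∈ H → x = 0)

theorem Transverse.injective_fst {H : AddSubgroup (ZMod τ × ZMod σ)} (hH : Transverse H) :
    Function.Injective ((AddMonoidHom.fst (ZMod τ) (ZMod σ)).comp H.subtype) := by
  rw [injective_iff_map_eq_zero]
  rintro ⟨⟨t, x⟩, h⟩ (rfl : t = 0)
  simp [hH.2 x h]

theorem Transverse.injective_snd {H : AddSubgroup (ZMod τ × ZMod σ)} (hH : Transverse H) :
    Function.Injective ((AddMonoidHom.snd (ZMod τ) (ZMod σ)).comp H.subtype) := by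
  rw [injective_iff_map_eq_zero]
  rintro ⟨⟨t, x⟩, h⟩ (rfl : x = 0)
  simp [hH.1 t h]

theorem Transverse.addOrderOf_eq {H : AddSubgroup (ZMod τ × ZMod σ)} (hH : Transverse H)
    {g : ZMod τ × ZMod σ} (hg : g ∈ H) :
    addOrderOf g.1 = addOrderOf g ∧ addOrderOf g.2 = addOrderOf g := by
  have h1 := addOrderOf_injective _ hH.injective_fst ⟨g, hg⟩
  have h2 := addOrderOf_injective _ hH.injective_snd ⟨g, hg⟩
  rw [← AddSubgroup.addOrderOf_coe] at h1 h2
  exact ⟨h1, h2⟩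

theorem transverse_zmultiples {g : ZMod τ × ZMod σ} (h : addOrderOf g.1 = addOrderOf g.2) :
    Transverse (AddSubgroup.zmultiples g) := by
  constructor
  · rintro t ⟨k, hk⟩
    obtain ⟨rfl, h2⟩ := Prod.ext_iff.1 hk
    have h2 : k • g.2 = 0 := h2
    change k • g.1 = 0
    rwa [← addOrderOf_dvd_iff_zsmul_eq_zero, h, addOrderOf_dvd_iff_zsmul_eq_zero]
  · rintro t ⟨k, hk⟩
    obtain ⟨h2, rfl⟩ := Prod.ext_iff.1 hk
    have h2 : k • g.1 = 0 := h2
    change k • g.2 = 0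
    rwa [← addOrderOf_dvd_iff_zsmul_eq_zero, ← h, addOrderOf_dvd_iff_zsmul_eq_zero]

variable [NeZero τ] [NeZero σ]

theorem Transverse.card_dvd {H : AddSubgroup (ZMod τ × ZMod σ)} (hH : Transverse H) :
    Nat.card H ∣ Nat.gcd τ σ := by
  refine Nat.dvd_gcd ?_ ?_
  · simpa using AddSubgroup.card_dvd_of_injective _ hH.injective_fst
  · simpa using AddSubgroup.card_dvd_of_injective _ hH.injective_snd

/-- Projection to the first coordinate is injective on `H`, so `H` embeds in a cyclic group and is
cyclic. -/
theorem Transverse.card_generators {H : AddSubgroup (ZMod τ × ZMod σ)} (hH : Transverse H) :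
    (Finset.univ.filter fun g : ZMod τ × ZMod σ => g ∈ H ∧ addOrderOf g = Nat.card H).card =
      Nat.totient (Nat.card H) := by
  have : IsAddCyclic H := isAddCyclic_of_injective _ hH.injective_fst
  rw [← IsAddCyclic.card_addOrderOf_eq_totient (α := H) (d := Nat.card H)
    (by rw [Nat.card_eq_fintype_card])]
  symm
  refine Finset.card_bij (fun h _ => (h : ZMod τ × ZMod σ)) ?_ ?_ ?_
  · rintro ⟨g, hg⟩ h
    rw [Finset.mem_filter, ← AddSubgroup.addOrderOf_coe] at h
    exact Finset.mem_filter.2 ⟨Finset.mem_univ _, hg, h.2⟩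
  · intro a _ b _ hab
    exact Subtype.ext hab
  · intro g hg
    obtain ⟨-, hg, h⟩ := Finset.mem_filter.1 hg
    refine ⟨⟨g, hg⟩, ?_, rfl⟩
    rw [Finset.mem_filter, ← AddSubgroup.addOrderOf_coe]
    exact ⟨Finset.mem_univ _, h⟩

/-- The number of transverse subgroups of a given order. -/
theorem card_transverse {d : ℕ} (hτ : d ∣ τ) (hσ : d ∣ σ) :
    (Finset.univ.filter fun H : AddSubgroup (ZMod τ × ZMod σ) =>
      Transverse H ∧ Nat.card H = d).card = Nat.totient d := by
  have hd : 0 < d := Nat.pos_of_dvd_of_pos hτ (Nat.pos_of_ne_zero (NeZero.ne τ))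
  -- Double counting: `P` has `φ(d) ^ 2` elements, and each transverse subgroup of order `d`
  -- contains exactly `φ(d)` of them, namely its generators.
  set P := (Finset.univ.filter fun t : ZMod τ => addOrderOf t = d) ×ˢ
    (Finset.univ.filter fun x : ZMod σ => addOrderOf x = d) with hP
  have hPcard : P.card = Nat.totient d * Nat.totient d := by
    rw [hP, Finset.card_product, IsAddCyclic.card_addOrderOf_eq_totient (by simpa using hτ),
      IsAddCyclic.card_addOrderOf_eq_totient (by simpa using hσ)]
  have hmem : ∀ g, g ∈ P ↔ addOrderOf g.1 = d ∧ addOrderOf g.2 = d := by simp [hP]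
  have hord : ∀ g ∈ P, addOrderOf g = d := by
    intro g hg
    obtain ⟨h1, h2⟩ := (hmem g).1 hg
    rw [Prod.addOrderOf, h1, h2, Nat.lcm_self]
  have hfib := Finset.card_eq_sum_card_fiberwise (s := P)
    (t := Finset.univ.filter fun H : AddSubgroup (ZMod τ × ZMod σ) =>
      Transverse H ∧ Nat.card H = d) (f := fun g => AddSubgroup.zmultiples g) (by
        intro g hg
        obtain ⟨h1, h2⟩ := (hmem g).1 hg
        simp only [Finset.coe_filter, Finset.mem_univ, true_and, Set.mem_ofPred_eq]
        exact ⟨transverse_zmultiples (h1.trans h2.symm), by rw [Nat.card_zmultiples, hord g hg]⟩)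
  have hconst : ∀ H ∈ Finset.univ.filter (fun H : AddSubgroup (ZMod τ × ZMod σ) =>
      Transverse H ∧ Nat.card H = d),
      (P.filter fun g => AddSubgroup.zmultiples g = H).card = Nat.totient d := by
    intro H hH
    obtain ⟨-, htr, rfl⟩ := Finset.mem_filter.1 hH
    rw [← htr.card_generators]
    congr 1
    ext g
    simp only [Finset.mem_filter, Finset.mem_univ, true_and]
    constructor
    · rintro ⟨hg, rfl⟩
      exact ⟨AddSubgroup.mem_zmultiples g, hord g hg⟩
    · rintro ⟨hg, hcard⟩
      obtain ⟨h1, h2⟩ := htr.addOrderOf_eq hg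
      refine ⟨(hmem g).2 ⟨h1.trans hcard, h2.trans hcard⟩, ?_⟩
      refine AddSubgroup.eq_of_le_of_card_ge ((AddSubgroup.zmultiples_le_of_mem hg)) ?_
      rw [Nat.card_zmultiples, hcard]
  rw [Finset.sum_congr rfl hconst, hPcard, Finset.sum_const, smul_eq_mul] at hfib
  exact (Nat.eq_of_mul_eq_mul_right (Nat.totient_pos.2 hd) hfib).symm

theorem sum_card_transverse :
    ∑ H : AddSubgroup (ZMod τ × ZMod σ) with Transverse H, (Nat.card H : ℝ) =
      ∑ d ∈ (Nat.gcd τ σ).divisors, (Nat.totient d : ℝ) * (d : ℝ) := by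
  rw [← Finset.sum_fiberwise_of_maps_to (t := (Nat.gcd τ σ).divisors)
    (g := fun H : AddSubgroup (ZMod τ × ZMod σ) => Nat.card H)]
  · refine Finset.sum_congr rfl fun d hd => ?_
    have hd := (Nat.mem_divisors.1 hd).1
    rw [← card_transverse (hd.trans (Nat.gcd_dvd_left τ σ)) (hd.trans (Nat.gcd_dvd_right τ σ)),
      Finset.filter_filter, Finset.sum_congr rfl
      (g := fun _ => (d : ℝ)) fun H hH => by rw [(Finset.mem_filter.1 hH).2.2],
      Finset.sum_const, nsmul_eq_mul]
  · intro H hH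
    exact Nat.mem_divisors.2 ⟨(Finset.mem_filter.1 hH).2.card_dvd,
      (Nat.gcd_pos_of_pos_left _ (Nat.pos_of_ne_zero (NeZero.ne τ))).ne'⟩

theorem sum_inv_index_transverse :
    ∑ H : AddSubgroup (ZMod τ × ZMod σ) with Transverse H,
      (Nat.card ((ZMod τ × ZMod σ) ⧸ H) : ℝ)⁻¹ = lam τ σ := by
  have hτ : (τ : ℝ) ≠ 0 := by exact_mod_cast NeZero.ne τ
  have hσ : (σ : ℝ) ≠ 0 := by exact_mod_cast NeZero.ne σ
  rw [lam, ← sum_card_transverse, Finset.mul_sum]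
  refine Finset.sum_congr rfl fun H _ => ?_
  have h := AddSubgroup.card_eq_card_quotient_mul_card_addSubgroup H
  rw [Nat.card_prod, Nat.card_zmod, Nat.card_zmod] at h
  have hH : (Nat.card H : ℝ) ≠ 0 := by exact_mod_cast Nat.card_pos.ne'
  have hQ : (Nat.card ((ZMod τ × ZMod σ) ⧸ H) : ℝ) ≠ 0 := by exact_mod_cast Nat.card_pos.ne'
  have h' : (τ : ℝ) * σ = Nat.card ((ZMod τ × ZMod σ) ⧸ H) * Nat.card H := by exact_mod_cast h
  rw [h']
  field_simp

end TransverseSubgroups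

/-! ### Simple patterns by invariance subgroup, and the limiting mean -/

section Counting

variable {n τ σ : ℕ} [NeZero τ] [NeZero σ]

/-- The translations that leave the pattern `u` invariant. -/
def invariance (u : ZMod τ × ZMod σ → Fin n) : AddSubgroup (ZMod τ × ZMod σ) where
  carrier := {g | ∀ p, u (p + g) = u p}
  zero_mem' p := by rw [add_zero]
  add_mem' {g h} hg hh p := by rw [← add_assoc, hh, hg]
  neg_mem' {g} hg p := by rw [← hg (p + -g), neg_add_cancel_right]

omit [NeZero τ] [NeZero σ] in
theorem mem_invariance {u : ZMod τ × ZMod σ → Fin n} {g : ZMod τ × ZMod σ} :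
    g ∈ invariance u ↔ ∀ p, u (p + g) = u p := Iff.rfl

theorem mem_simplePatterns {u : ZMod τ × ZMod σ → Fin n} :
    u ∈ simplePatterns n τ σ ↔ IsMinimal u ∧ IsSimple (constraints u) := by
  simp [simplePatterns]

omit [NeZero τ] [NeZero σ] in
theorem isMinimal_iff_transverse {u : ZMod τ × ZMod σ → Fin n} :
    IsMinimal u ↔ Transverse (invariance u) := Iff.rfl

/-- By rigidity, two sites carry the same state only if their difference is a translation symmetry.
The right-hand side says that `u` descends to an injection on the quotient by `H`. -/
theorem mem_simplePatterns_and_invariance_eq_iff {u : ZMod τ × ZMod σ → Fin n}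
    {H : AddSubgroup (ZMod τ × ZMod σ)} (hH : Transverse H) :
    (u ∈ simplePatterns n τ σ ∧ invariance u = H) ↔ ∀ p q, u p = u q ↔ -p + q ∈ H := by
  rw [mem_simplePatterns]
  constructor
  · rintro ⟨⟨-, hs⟩, rfl⟩ p q
    constructor
    · intro h r
      have := hs.eq_add h (-p + r)
      rw [add_neg_cancel_left] at this
      rw [this]
      congr 1
      abel
    · intro h
      have := h p
      rw [add_neg_cancel_left] at this
      exact this.symm
  · intro h
    have hinv : invariance u = H := by
      ext g
      rw [mem_invariance]
      constructor
      · intro hg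
        have := (h 0 g).1 (by simpa using (hg 0).symm)
        simpa using this
      · intro hg p
        refine ((h _ _).2 ?_).symm
        rwa [neg_add_cancel_left]
    refine ⟨⟨isMinimal_iff_transverse.2 (hinv ▸ hH), ?_⟩, hinv⟩
    intro c hc d hd hcd
    obtain ⟨p, -, rfl⟩ := Finset.mem_image.1 hc
    obtain ⟨q, -, rfl⟩ := Finset.mem_image.1 hd
    have hpq := (h p q).1 hcd
    have hv : ∀ v, u (p - v) = u (q - v) := fun v => (h _ _).2 (by
      rwa [show -(p - v) + (q - v) = -p + q by abel])
    exact Prod.ext (Prod.ext (hv _) (hv _)) hcd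

theorem card_simplePatterns_with_invariance {H : AddSubgroup (ZMod τ × ZMod σ)}
    (hH : Transverse H) :
    ((simplePatterns n τ σ).filter fun u => invariance u = H).card =
      n.descFactorial (Nat.card ((ZMod τ × ZMod σ) ⧸ H)) := by
  rw [Nat.card_eq_fintype_card]
  conv_rhs => rw [← Fintype.card_fin n, ← Fintype.card_embedding_eq, ← Finset.card_univ]
  symm
  refine Finset.card_bij (fun e _ p => e (p : (ZMod τ × ZMod σ) ⧸ H)) ?_ ?_ ?_
  · intro e _
    rw [Finset.mem_filter, mem_simplePatterns_and_invariance_eq_iff hH]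
    intro p q
    rw [e.injective.eq_iff, QuotientAddGroup.eq]
  · intro e _ e' _ h
    ext x
    obtain ⟨p, rfl⟩ := QuotientAddGroup.mk_surjective x
    rw [congrFun h p]
  · intro u hu
    rw [Finset.mem_filter, mem_simplePatterns_and_invariance_eq_iff hH] at hu
    refine ⟨⟨fun x => Quotient.liftOn' x u fun p q hpq =>
      (hu p q).2 (QuotientAddGroup.leftRel_apply.1 hpq), ?_⟩, Finset.mem_univ _, rfl⟩
    intro x x' h
    obtain ⟨p, rfl⟩ := QuotientAddGroup.mk_surjective x
    obtain ⟨q, rfl⟩ := QuotientAddGroup.mk_surjective x'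
    exact QuotientAddGroup.eq.2 ((hu p q).1 h)

theorem card_constraints_of_invariance_eq {H : AddSubgroup (ZMod τ × ZMod σ)}
    (hH : Transverse H) {u : ZMod τ × ZMod σ → Fin n}
    (hu : u ∈ simplePatterns n τ σ ∧ invariance u = H) :
    (constraints u).card = Nat.card ((ZMod τ × ZMod σ) ⧸ H) := by
  have h := (mem_simplePatterns_and_invariance_eq_iff hH).1 hu
  rw [← isSimple_iff_card.1 (mem_simplePatterns.1 hu.1).2, outputs_constraints,
    Nat.card_eq_fintype_card, ← Finset.card_univ]
  symm
  refine Finset.card_bij (fun x _ => Quotient.liftOn' x u fun p q hpq =>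
      (h p q).2 (QuotientAddGroup.leftRel_apply.1 hpq)) ?_ ?_ ?_
  · intro x _
    obtain ⟨p, rfl⟩ := QuotientAddGroup.mk_surjective x
    exact Finset.mem_image_of_mem _ (Finset.mem_univ p)
  · intro x _ x' _ hx
    obtain ⟨p, rfl⟩ := QuotientAddGroup.mk_surjective x
    obtain ⟨q, rfl⟩ := QuotientAddGroup.mk_surjective x'
    exact QuotientAddGroup.eq.2 ((h p q).1 hx)
  · intro c hc
    obtain ⟨p, -, rfl⟩ := Finset.mem_image.1 hc
    exact ⟨QuotientAddGroup.mk p, Finset.mem_univ _, rfl⟩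

/-- Each constraint set comes from as many simple patterns as it has elements. -/
theorem card_simplePatterns_with_constraints {u : ZMod τ × ZMod σ → Fin n}
    (hu : u ∈ simplePatterns n τ σ) :
    ((simplePatterns n τ σ).filter fun v => constraints v = constraints u).card =
      (constraints u).card := by
  obtain ⟨hmin, hs⟩ := mem_simplePatterns.1 hu
  rw [← isSimple_iff_card.1 hs]
  -- A pattern with these constraints is determined by its state at the origin, and translating `u`
  -- puts any of its states there.
  refine Finset.card_bij (fun v _ => v 0) ?_ ?_ ?_
  · intro v hv
    rw [← (Finset.mem_filter.1 hv).2]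
    exact mem_outputs_constraints v 0
  · intro v hv w hw h
    ext p
    obtain ⟨i, j, rfl⟩ := proj_surjective p
    have hT : IsSimple (constraints v ∪ constraints w) := by
      rwa [(Finset.mem_filter.1 hv).2, (Finset.mem_filter.1 hw).2, Finset.union_self]
    have := eq_of_eq_at hT h i j
    rw [zero_add] at this
    rw [this]
  · intro c hc
    rw [outputs_constraints] at hc
    obtain ⟨p, -, rfl⟩ := Finset.mem_image.1 hc
    refine ⟨fun q => u (q + p), Finset.mem_filter.2 ⟨mem_simplePatterns.2
      ⟨hmin.translate p, ?_⟩, constraints_translate u p⟩, by simp⟩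
    rwa [constraints_translate]

/-- Weighting each pattern by one over its number of constraints counts each constraint set once;
the patterns are then grouped by invariance subgroup. -/
theorem sum_image_constraints (w : ℕ → ℝ) :
    ∑ S ∈ (simplePatterns n τ σ).image constraints, w S.card =
      ∑ H : AddSubgroup (ZMod τ × ZMod σ) with Transverse H,
        (n.descFactorial (Nat.card ((ZMod τ × ZMod σ) ⧸ H)) : ℝ) *
          ((Nat.card ((ZMod τ × ZMod σ) ⧸ H) : ℝ)⁻¹ *
            w (Nat.card ((ZMod τ × ZMod σ) ⧸ H))) := by
  have h1 : ∑ u ∈ simplePatterns n τ σ,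
      (((constraints u).card : ℝ)⁻¹ * w (constraints u).card) =
      ∑ S ∈ (simplePatterns n τ σ).image constraints, w S.card := by
    rw [Finset.sum_comp (fun S : Finset ((Fin n × Fin n) × Fin n) =>
      ((S.card : ℝ)⁻¹ * w S.card)) constraints]
    refine Finset.sum_congr rfl fun S hS => ?_
    obtain ⟨u, hu, rfl⟩ := Finset.mem_image.1 hS
    rw [card_simplePatterns_with_constraints hu, nsmul_eq_mul, ← mul_assoc, mul_inv_cancel₀,
      one_mul]
    exact_mod_cast (Finset.card_pos.2 (constraints_nonempty u)).ne'
  rw [← h1, ← Finset.sum_fiberwise_of_maps_to (g := invariance)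
    (t := Finset.univ.filter fun H : AddSubgroup (ZMod τ × ZMod σ) => Transverse H)]
  · refine Finset.sum_congr rfl fun H hH => ?_
    have hH := (Finset.mem_filter.1 hH).2
    rw [← card_simplePatterns_with_invariance hH, ← nsmul_eq_mul, ← Finset.sum_const]
    refine Finset.sum_congr rfl fun u hu => ?_
    rw [card_constraints_of_invariance_eq hH (Finset.mem_filter.1 hu)]
  · intro u hu
    exact Finset.mem_filter.2 ⟨Finset.mem_univ _,
      isMinimal_iff_transverse.1 (mem_simplePatterns.1 hu).1⟩

theorem tendsto_descFactorial_mul_inv_pow (m : ℕ) :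
    Tendsto (fun n : ℕ => (n.descFactorial m : ℝ) * (n : ℝ)⁻¹ ^ m) atTop (nhds 1) := by
  have h := isEquivalent_descFactorial m
  rw [Asymptotics.isEquivalent_iff_tendsto_one] at h
  · refine h.congr fun n => ?_
    rw [Pi.div_apply, inv_pow, div_eq_mul_inv]
  · filter_upwards [eventually_gt_atTop 0] with n hn
    have : (n : ℝ) ≠ 0 := by exact_mod_cast hn.ne'
    exact pow_ne_zero _ this

variable (τ σ) in
theorem tendsto_sum_image_constraints :
    Tendsto (fun n : ℕ => ∑ S ∈ (simplePatterns n τ σ).image constraints, (n : ℝ)⁻¹ ^ S.card)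
      atTop (nhds (lam τ σ)) := by
  rw [← sum_inv_index_transverse]
  refine (tendsto_finsetSum _ fun H _ => ?_).congr
    fun n => (sum_image_constraints fun m => (n : ℝ)⁻¹ ^ m).symm
  set m := Nat.card ((ZMod τ × ZMod σ) ⧸ H)
  have := (tendsto_descFactorial_mul_inv_pow m).const_mul ((m : ℝ)⁻¹)
  rw [mul_one] at this
  refine this.congr fun n => ?_
  ring

variable (τ) in
theorem tendsto_sum_simpleSets (y : ℕ) :
    Tendsto (fun n : ℕ => ∑ S ∈ simpleSets n τ y, (n : ℝ)⁻¹ ^ S.card)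
      atTop (nhds (∑ σ ∈ Finset.Icc 1 y, lam τ σ)) := by
  have e : ∑ σ ∈ Finset.Icc 1 y, lam τ σ = ∑ k ∈ Finset.range y, lam τ (k + 1) := by
    rw [Finset.range_eq_Ico, Finset.sum_Ico_add' (fun k => lam τ k) 0 y 1]
    rfl
  rw [e]
  refine (tendsto_finsetSum (Finset.range y) fun k _ =>
    tendsto_sum_image_constraints τ (k + 1)).congr fun n => ?_
  rw [simpleSets, Finset.sum_biUnion]
  -- Different spatial periods give disjoint families, since a simple constraint set determines its
  -- spatial period.
  intro k _ k' _ hkk'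
  rw [Function.onFun, Finset.disjoint_left]
  intro S hS hS'
  obtain ⟨u, hu, rfl⟩ := Finset.mem_image.1 hS
  obtain ⟨u', hu', huu'⟩ := Finset.mem_image.1 hS'
  rw [mem_simplePatterns] at hu hu'
  have := (constraints_eq_of_not_disjoint hu.1 hu'.1 (by rw [huu', Finset.union_self]; exact hu.2)
    (by
      rw [huu', disjoint_self]
      exact ((constraints_nonempty u).image _).ne_empty)).2
  omega

variable (τ) in
theorem tendsto_prob_smallestSpatialPeriod_le (y : ℕ) :
    Tendsto (fun n : ℕ => prob fun f : Rule n => smallestSpatialPeriod τ f ≤ (y : ℕ∞)) atTop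
      (nhds (1 - Real.exp (-∑ σ ∈ Finset.Icc 1 y, lam τ σ))) := by
  have h1 := ((tendsto_sum_simpleSets τ y).neg.rexp).const_sub 1
  set C : ℝ := 2 * (((2 * (τ * y) : ℕ) + 1) * 4 ^ (2 * (τ * y)) ^ 3) +
        ((τ * y : ℕ) + 1) * 4 ^ (τ * y) ^ 3
  have h2 : Tendsto (fun n : ℕ => C * (n : ℝ)⁻¹) atTop (nhds 0) := by
    simpa using tendsto_inv_atTop_nhds_zero_nat.const_mul C
  have h3 := squeeze_zero_norm' (a := fun n : ℕ => C * (n : ℝ)⁻¹) (f := fun n : ℕ =>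
      prob (fun f : Rule n => smallestSpatialPeriod τ f ≤ (y : ℕ∞)) -
        (1 - Real.exp (-∑ S ∈ simpleSets n τ y, (n : ℝ)⁻¹ ^ S.card))) (by
    filter_upwards [eventually_ne_atTop 0] with n hn
    have : NeZero n := ⟨hn⟩
    exact abs_prob_smallestSpatialPeriod_le_sub) h2
  simpa using h3.add h1

end Counting

/-! ### The limit law and convergence in distribution -/

section Limit

theorem exists_probabilityMeasure_nat {F : ℕ → ℝ} (h0 : F 0 = 0) (hF : Monotone F)
    (h1 : Tendsto F atTop (nhds 1)) :
    ∃ μ : ProbabilityMeasure ℕ, ∀ y, (μ : Measure ℕ).real (Set.Iic y) = F y := by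
  have hnonneg : ∀ k, 0 ≤ F k - F (k - 1) := fun k => sub_nonneg.2 (hF (Nat.sub_le k 1))
  have hsum : ∀ m, ∑ k ∈ Finset.range (m + 1), (F k - F (k - 1)) = F m := by
    intro m
    rw [Finset.sum_range_succ', Finset.sum_congr rfl fun k _ => by rw [Nat.add_sub_cancel],
      Finset.sum_range_sub, h0]
    simp
  have hhas : HasSum (fun k => F k - F (k - 1)) 1 := by
    rw [hasSum_iff_tendsto_nat_of_nonneg hnonneg, ← tendsto_add_atTop_iff_nat 1]
    simpa only [hsum] using h1
  have htsum : ∑' k, ENNReal.ofReal (F k - F (k - 1)) = 1 := by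
    rw [← ENNReal.ofReal_tsum_of_nonneg hnonneg hhas.summable, hhas.tsum_eq, ENNReal.ofReal_one]
  -- At `k = 0` the truncated subtraction gives mass zero, consistent with `F 0 = 0`.
  let p : PMF ℕ := ⟨fun k => ENNReal.ofReal (F k - F (k - 1)),
    ENNReal.summable.hasSum_iff.2 htsum⟩
  refine ⟨⟨p.toMeasure, inferInstance⟩, fun y => ?_⟩
  have hset : Set.Iic y = ((Finset.range (y + 1) : Finset ℕ) : Set ℕ) := by
    ext k
    simp
  rw [hset, Measure.real, ProbabilityMeasure.coe_mk, PMF.toMeasure_apply_finset]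
  change (∑ k ∈ Finset.range (y + 1), ENNReal.ofReal (F k - F (k - 1))).toReal = F y
  rw [← ENNReal.ofReal_sum_of_nonneg fun k _ => hnonneg k, hsum, ENNReal.toReal_ofReal]
  rw [← h0]
  exact hF (Nat.zero_le y)

/-- Convergence of distribution functions to that of a law on `ℕ` implies convergence in
distribution. -/
theorem tendstoInDistribution_of_tendsto_real_le {Ω : ℕ → Type*}
    [∀ n, MeasurableSpace (Ω n)] (P : (n : ℕ) → Measure (Ω n))
    [∀ n, IsProbabilityMeasure (P n)] (Y : (n : ℕ) → Ω n → ℕ∞) (hY : ∀ n, Measurable (Y n))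
    (μ : Measure ℕ) [IsProbabilityMeasure μ]
    (h : ∀ y : ℕ, Tendsto (fun n => (P n).real {ω | Y n ω ≤ (y : ℕ∞)}) atTop
      (nhds (μ.real (Set.Iic y)))) :
    TendstoInDistribution Y atTop (fun k : ℕ => (k : ℕ∞)) P μ := by
  have hcast : Measurable (fun k : ℕ => (k : ℕ∞)) := measurable_of_countable _
  have hpoint : ∀ k : ℕ, Tendsto (fun n => (P n).real (Y n ⁻¹' {(k : ℕ∞)})) atTop
      (nhds (μ.real {k})) := by
    intro k
    cases k with
    | zero =>
      convert h 0 using 3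
      · ext ω
        simp
      · ext j
        simp
    | succ k =>
      have e1 : μ.real {k + 1} = μ.real (Set.Iic (k + 1)) - μ.real (Set.Iic k) := by
        rw [← measureReal_sdiff (Set.Iic_subset_Iic.2 (Nat.le_succ k)) (by measurability)]
        congr 1
        ext j
        simp
        omega
      have e2 : ∀ n, (P n).real (Y n ⁻¹' {((k + 1 : ℕ) : ℕ∞)}) =
          (P n).real {ω | Y n ω ≤ ((k + 1 : ℕ) : ℕ∞)} - (P n).real {ω | Y n ω ≤ (k : ℕ∞)} := by
        intro n
        rw [← measureReal_sdiff]
        · congr 1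
          ext ω
          simp only [Set.mem_preimage, Set.mem_singleton_iff, Set.mem_sdiff, Set.mem_ofPred_eq,
            not_le]
          constructor
          · intro hω
            rw [hω]
            exact ⟨le_rfl, by exact_mod_cast Nat.lt_succ_self k⟩
          · rintro ⟨h1, h2⟩
            refine le_antisymm h1 ?_
            push_cast
            exact Order.add_one_le_of_lt h2
        · intro ω hω
          have hk : (k : ℕ∞) ≤ ((k + 1 : ℕ) : ℕ∞) := by exact_mod_cast Nat.le_succ k
          exact le_trans (show Y n ω ≤ (k : ℕ∞) from hω) hk
        · exact hY n (Set.to_countable _).measurableSet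
      simp only [e1, e2]
      exact (h (k + 1)).sub (h k)
  refine ⟨fun n => (hY n).aemeasurable, hcast.aemeasurable,
    tendsto_of_forall_isOpen_le_liminf_nat' fun G _ => ?_⟩
  simp only [ProbabilityMeasure.coe_mk]
  have hG : MeasurableSet G := trivial
  rw [Measure.map_apply hcast hG]
  simp only [Measure.map_apply (hY _) hG]
  rw [← Measure.tsum_indicator_apply_singleton _ _ (hcast hG), ENNReal.tsum_eq_iSup_sum]
  -- The limit law lives on `ℕ`, so finitely many atoms approximate its mass of `G` from below, and
  -- on those the convergence is pointwise.
  refine iSup_le fun s => ?_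
  set A : Finset ℕ := Finset.filter (fun k : ℕ => (k : ℕ∞) ∈ G) s with hA
  have hlim : Tendsto (fun n => ∑ k ∈ A, P n (Y n ⁻¹' {(k : ℕ∞)})) atTop
      (nhds (∑ k ∈ A, μ {k})) := by
    refine tendsto_finsetSum _ fun k _ => ?_
    rw [← ENNReal.tendsto_toReal_iff (fun n => measure_ne_top _ _) (measure_ne_top _ _)]
    exact hpoint k
  have hle : ∀ n, ∑ k ∈ A, P n (Y n ⁻¹' {(k : ℕ∞)}) ≤ P n (Y n ⁻¹' G) := by
    intro n
    rw [← measure_biUnion_finset]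
    · refine measure_mono (Set.iUnion₂_subset fun k hk ω hω => ?_)
      have hω : Y n ω = k := hω
      rw [Set.mem_preimage, hω]
      exact (Finset.mem_filter.1 hk).2
    · intro k _ k' _ hkk'
      rw [Function.onFun, Set.disjoint_left]
      intro ω hω hω'
      exact hkk' (by exact_mod_cast (show (k : ℕ∞) = k' from Eq.trans (Eq.symm hω) hω'))
    · exact fun k _ => hY n trivial
  calc _ = ∑ k ∈ A, μ {k} := by
        rw [hA, Finset.sum_filter]
        rfl
    _ = liminf (fun n => ∑ k ∈ A, P n (Y n ⁻¹' {(k : ℕ∞)})) atTop := hlim.liminf_eq.symm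
    _ ≤ _ := liminf_le_liminf (Eventually.of_forall hle)

theorem lam_nonneg (τ σ : ℕ) : 0 ≤ lam τ σ := by
  unfold lam
  positivity

theorem one_div_le_lam {τ σ : ℕ} (hτ : 1 ≤ τ) : 1 / ((τ : ℝ) * σ) ≤ lam τ σ := by
  unfold lam
  refine le_mul_of_one_le_right (by positivity) ?_
  have h1 : (1 : ℕ) ∈ (Nat.gcd τ σ).divisors :=
    Nat.mem_divisors.2 ⟨one_dvd _, (Nat.gcd_pos_of_pos_left _ hτ).ne'⟩
  refine le_trans ?_ (Finset.single_le_sum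
    (f := fun d : ℕ => (Nat.totient d : ℝ) * (d : ℝ)) (fun d _ => by positivity) h1)
  simp

/-- Comparison with the harmonic series, through the term `d = 1` of `lam`. This is what makes the
limit a probability law on the integers. -/
theorem tendsto_sum_lam {τ : ℕ} (hτ : 1 ≤ τ) :
    Tendsto (fun y : ℕ => ∑ σ ∈ Finset.Icc 1 y, lam τ σ) atTop atTop := by
  have hτ0 : (0 : ℝ) < (τ : ℝ)⁻¹ := by positivity
  refine tendsto_atTop_mono (fun y => ?_)
    (Real.tendsto_sum_range_one_div_nat_succ_atTop.const_mul_atTop hτ0)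
  have e : ∑ σ ∈ Finset.Icc 1 y, lam τ σ = ∑ k ∈ Finset.range y, lam τ (k + 1) := by
    rw [Finset.range_eq_Ico, Finset.sum_Ico_add' (fun k => lam τ k) 0 y 1]
    rfl
  rw [e, Finset.mul_sum]
  refine Finset.sum_le_sum fun k _ => ?_
  refine le_trans (le_of_eq ?_) (one_div_le_lam hτ)
  push_cast
  field_simp

end Limit

end RandomCA

theorem corollary2 (τ : ℕ) (hτ : 1 ≤ τ) :
    ∃ μ : ProbabilityMeasure ℕ,
      -- convergence in distribution, in `ℕ∞ = ℕ ∪ {∞}`, to the law `μ` on `ℕ`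
      TendstoInDistribution
        (fun (n : ℕ) (f : RandomCA.Rule n) => RandomCA.smallestSpatialPeriod τ f) atTop
        (fun k : ℕ => (k : ℕ∞)) (fun n : ℕ => RandomCA.uniformRule n) (μ : Measure ℕ) ∧
      -- convergence of the distribution functions
      (∀ y : ℕ, Tendsto
        (fun n : ℕ => (RandomCA.uniformRule n).real
          {f : RandomCA.Rule n | RandomCA.smallestSpatialPeriod τ f ≤ (y : ℕ∞)}) atTop
        (nhds (1 - Real.exp (-∑ σ ∈ Finset.Icc 1 y, RandomCA.lam τ σ)))) ∧
      -- the distribution function of the limit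
      (∀ y : ℕ, (μ : Measure ℕ).real (Set.Iic y) =
        1 - Real.exp (-∑ σ ∈ Finset.Icc 1 y, RandomCA.lam τ σ)) ∧
      -- the limit is nontrivial: it is not concentrated at a single point
      (∀ k : ℕ, (μ : Measure ℕ) {k} ≠ 1) := by
  have : NeZero τ := ⟨by omega⟩
  obtain ⟨μ, hμ⟩ := RandomCA.exists_probabilityMeasure_nat
    (F := fun y => 1 - Real.exp (-∑ σ ∈ Finset.Icc 1 y, RandomCA.lam τ σ)) (by simp)
    (by
      intro y y' hy
      refine sub_le_sub_left (Real.exp_le_exp.2 (neg_le_neg ?_)) 1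
      exact Finset.sum_le_sum_of_subset_of_nonneg (Finset.Icc_subset_Icc_right hy)
        fun σ _ _ => RandomCA.lam_nonneg τ σ)
    (by
      have := (Real.tendsto_exp_neg_atTop_nhds_zero.comp (RandomCA.tendsto_sum_lam hτ)).const_sub 1
      simpa using this)
  have hcdf : ∀ y : ℕ, Tendsto
      (fun n : ℕ => (RandomCA.uniformRule n).real
        {f : RandomCA.Rule n | RandomCA.smallestSpatialPeriod τ f ≤ (y : ℕ∞)}) atTop
      (nhds (1 - Real.exp (-∑ σ ∈ Finset.Icc 1 y, RandomCA.lam τ σ))) := fun y => by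
    simpa only [RandomCA.uniformRule_real_eq_prob] using
      RandomCA.tendsto_prob_smallestSpatialPeriod_le τ y
  refine ⟨μ, RandomCA.tendstoInDistribution_of_tendsto_real_le _ _
    (fun n => measurable_of_finite _) _ fun y => ?_, hcdf, hμ, fun k hk => ?_⟩
  · rw [hμ]
    exact hcdf y
  -- An atom at `k` has at most the mass of `Set.Iic k`, which is strictly below `1` because the
  -- exponential is positive.
  · have h1 : (μ : Measure ℕ).real {k} ≤ (μ : Measure ℕ).real (Set.Iic k) :=
      measureReal_mono (by simp)
    rw [hμ, Measure.real, hk, ENNReal.toReal_one] at h1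
    linarith [Real.exp_pos (-∑ σ ∈ Finset.Icc 1 k, RandomCA.lam τ σ)]
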